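/- Let $\mathcal R=(R,<,+,0,\dots)$ be an expansion of a densely linearly ordered abelian group; "definable" means definable in $\mathcal R$ with parameters, $R$ carries the order topology and $R^n$ the product topology. Intervals have endpoints in $R$, an open box in $R^m$ is a product of $m$ open intervals, and for $X\subseteq R^{m+n}$ and $x\in R^m$ we put $X_x=\{y\in R^n : (x,y)\in X\}$. Assume: (DC) $\mathcal R$ is definably complete: every nonempty definable subset of $R$ that is bounded above (below) has a supremum (infimum) in $R$. (LUF$_2$) For all $m\ge 0$, every definable $X\subseteq R^{m+1}$, $a\in R$ and $b\in R^m$, there exist a positive integer $N$, a closed interval $I$ with $a\in\operatorname{int}(I)$ and an open box $U\subseteq R^m$ with $b\in U$ such that, for all $x\in U$ and all closed intervals $J$ with $a\in\operatorname{int}(J)\subseteq I$, the set $X_x\cap J$ is infinite or has at most $N$ elements. A definable set $X\subseteq R^n$ is called a $D_\Sigma$-set if there is a definable set $D\subseteq R^{2+n}$ whose fibers $X_{r,s}=D_{(r,s)}$ ($r,s>0$) are closed and bounded, satisfy $X_{r,s}\subseteq X_{r',s}$ and $X_{r,s'}\subseteq X_{r,s}$ whenever $0<r\le r'$ and $0<s\le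 s'$, and satisfy $X=\bigcup_{r>0,\,s>0}X_{r,s}$. A subset of $R^n$ is called constructible if it is a finite boolean combination of open subsets of $R^n$. The open core of $\mathcal R$ is the structure with universe $R$ whose basic relations are all the open subsets of $R^n$, $n\ge 0$, that are definable in $\mathcal R$. Then, for every $n\ge 0$, every $D_\Sigma$-set $X\subseteq R^n$ is constructible. In particular, every subset of $R^n$ definable (with parameters) in the open core of $\mathcal R$ is constructible. -/

import Mathlib

open Set

universe u v w

namespace OpenCore

/-- A subset of `R^α` definable in the structure `R`, with arbitrary parameters from `R`. -/
abbrev Def (L : FirstOrder.Language.{u, v}) {R : Type w} [L.Structure R] {α : Type*}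
    (s : Set (α → R)) : Prop :=
  (univ : Set R).Definable L s

/-- The `L`-structure `R` is an expansion of the ordered group `(R, <, +, 0)`: the order relation
and the graph of addition are among its definable sets. (Definability always allows parameters,
so it does not matter whether `<`, `+`, `0` are symbols of `L` or are given by formulas.) -/
structure ExpandsOrderedGroup (L : FirstOrder.Language.{u, v}) (R : Type w) [L.Structure R]
    [AddCommGroup R] [LinearOrder R] : Prop where
  lt_definable : Def L {x : Fin 2 → R | x 0 < x 1}
  add_definable : Def L {x : Fin 3 → R | x 0 + x 1 = x 2}

/-- Definable completeness: every definable subset of `R` has a supremum and an infimum in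
`R ∪ {±∞}`. -/
structure DefinablyComplete (L : FirstOrder.Language.{u, v}) (R : Type w) [L.Structure R]
    [LinearOrder R] : Prop where
  exists_isLUB : ∀ s : Set R, (univ : Set R).Definable₁ L s →
    s.Nonempty → BddAbove s → ∃ a, IsLUB s a
  exists_isGLB : ∀ s : Set R, (univ : Set R).Definable₁ L s →
    s.Nonempty → BddBelow s → ∃ a, IsGLB s a

/-- The open box `∏ i, (u i, v i)` in `R^m`. -/
def openBox {R : Type w} [LinearOrder R] {m : ℕ} (u v : Fin m → R) : Set (Fin m → R) :=
  {x | ∀ i, u i < x i ∧ x i < v i}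

/-- Local uniform finiteness of the second kind. -/
def LUF₂ (L : FirstOrder.Language.{u, v}) (R : Type w) [L.Structure R] [LinearOrder R]
    [TopologicalSpace R] : Prop :=
  ∀ (m : ℕ) (X : Set (Fin (m + 1) → R)), Def L X → ∀ (a : R) (b : Fin m → R),
    ∃ N : ℕ, 0 < N ∧
    ∃ c d : R, a ∈ interior (Icc c d) ∧
    ∃ u v : Fin m → R, b ∈ openBox u v ∧
      ∀ x ∈ openBox u v, ∀ c' d' : R,
        a ∈ interior (Icc c' d') → interior (Icc c' d') ⊆ Icc c d →
          ({y : R | (Fin.snoc x y : Fin (m + 1) → R) ∈ X} ∩ Icc c' d').Infinite ∨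
          ({y : R | (Fin.snoc x y : Fin (m + 1) → R) ∈ X} ∩ Icc c' d').encard ≤ N

/-- Closed, bounded and definable subsets of `R^n`. -/
structure IsCBD (L : FirstOrder.Language.{u, v}) {R : Type w} [L.Structure R] [LinearOrder R]
    [TopologicalSpace R] {n : ℕ} (S : Set (Fin n → R)) : Prop where
  isClosed : IsClosed S
  bounded : ∃ u v : Fin n → R, S ⊆ Icc u v
  definable : Def L S

/-- The fiber `X_{r,s} = {x ∈ R^n | (r, s, x) ∈ D}` of a set `D ⊆ R^{2+n}`. -/
def fiber₂ {R : Type w} {n : ℕ} (D : Set (Fin (2 + n) → R)) (r s : R) : Set (Fin n → R) :=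
  {x | Fin.append ![r, s] x ∈ D}

/-- The fibers `X_{r,s}` (`r, s > 0`) of `D` form a `D_Σ`-family. -/
structure IsDSigmaFamily (L : FirstOrder.Language.{u, v}) {R : Type w} [L.Structure R]
    [AddCommGroup R] [LinearOrder R] [TopologicalSpace R] {n : ℕ}
    (D : Set (Fin (2 + n) → R)) : Prop where
  definable : Def L D
  isCBD : ∀ r s : R, 0 < r → 0 < s → IsCBD L (fiber₂ D r s)
  mono : ∀ r r' s : R, 0 < r → 0 < s → r ≤ r' → fiber₂ D r s ⊆ fiber₂ D r' s
  anti : ∀ r s s' : R, 0 < r → 0 < s → s ≤ s' → fiber₂ D r s' ⊆ fiber₂ D r s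

/-- `D_Σ`-sets: definable sets that are the union of a `D_Σ`-family. -/
def IsDSigma (L : FirstOrder.Language.{u, v}) {R : Type w} [L.Structure R]
    [AddCommGroup R] [LinearOrder R] [TopologicalSpace R] {n : ℕ}
    (X : Set (Fin n → R)) : Prop :=
  Def L X ∧ ∃ D : Set (Fin (2 + n) → R), IsDSigmaFamily L D ∧
    X = {x | ∃ r s : R, 0 < r ∧ 0 < s ∧ x ∈ fiber₂ D r s}

/-- Finite boolean combinations of open sets. (Mathlib's `Topology.IsConstructible` only allows
retrocompact open sets and is a different notion.) -/
def IsBoolCombOfOpen {T : Type*} [TopologicalSpace T] (X : Set T) : Prop :=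
  X ∈ BooleanSubalgebra.closure {U : Set T | IsOpen U}

/-- The language of the open core: an `n`-ary relation symbol for every open subset of `R^n`
that is definable in the `L`-structure `R`. -/
def openCoreLanguage (L : FirstOrder.Language.{u, v}) (R : Type w) [L.Structure R]
    [TopologicalSpace R] : FirstOrder.Language.{0, w} where
  Functions _ := Empty
  Relations n := {U : Set (Fin n → R) // IsOpen U ∧ Def L U}

/-- The open core of `R`: each relation symbol is interpreted by the open set it names. -/
instance openCoreStructure (L : FirstOrder.Language.{u, v}) (R : Type w) [L.Structure R]
    [TopologicalSpace R] : (openCoreLanguage L R).Structure R where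
  funMap f := Empty.elim f
  RelMap U x := x ∈ U.1

end OpenCore

set_option linter.unusedSectionVars false

namespace OpenCore

open Topology

/-! Write $C=\overline{\overline X\setminus X}$. Off $C$ the set $X$ agrees with its closure, so
$X=(\overline X\setminus C)\cup(X\cap C)$, where $X\cap C$ is the part at which $X$ is not locally
closed. Measure the dimension of $X$ by the largest $k$ such that some projection to $k$ coordinates
has interior. The heart of the matter (`DSig.exists_interior_nonempty`) is that $X\cap C$ has
smaller dimension than $X$. Induction on dimension then shows at once that $X$ is constructible and
that its complement is again $D_\Sigma$. Since $D_\Sigma$-sets are stable under projection by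
definable compactness (`IsCB.image`), stability under complement makes every set definable in the
open core $D_\Sigma$, by induction on formulas.

Why the dimension drops: suppose $X\cap C$ projects onto a set with interior in $R^k$, but no
projection of $X$ to one further coordinate has interior. Then each further coordinate takes, over a
generic base point, a closed discrete set of values. Shrinking the base and a box of values
(`IsBaire.exists_subsingleton`) makes the projection injective on $X$ inside the box, while $X\cap
C$ still covers the base. By a Baire property one closed bounded member of a family exhausting $X$
already covers an open part of the base. By injectivity it contains all of $X$ there, so $X$ is
relatively closed there, which is absurd near a point of $C$.

The Baire property says that a $D_\Sigma$-union of sets without interior is nowhere dense. Local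
uniform finiteness yields it through `exists_encard_le`: closed discrete fibers of a definable
family have locally bounded cardinality. On the line, monotone unions of closed discrete sets
therefore stay closed and discrete. In passing from $T$ to $T\times R$ (`IsBaire.prod`), a somewhere
dense union would have discrete fibers with too many points near one place. -/

/-- A space identified, by means of finitely many coordinates, with a power of `R`. -/
class Coord (R : Type w) [TopologicalSpace R] (T : Type w) [TopologicalSpace T] where
  /-- The index type of the coordinates. -/
  ι : Type
  finite_index : Finite ι
  /-- The coordinates. -/
  e : T ≃ₜ (ι → R)

attribute [instance] Coord.finite_index

/-! ### Coordinates and coordinate maps -/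

section Coordinates

variable {R : Type w} [TopologicalSpace R]
  {S : Type w} [TopologicalSpace S] [Coord R S]
  {T : Type w} [TopologicalSpace T] [Coord R T]
  {V : Type w} [TopologicalSpace V] [Coord R V]

instance Coord.self : Coord R R where
  ι := Unit
  finite_index := inferInstance
  e := (Homeomorph.funUnique Unit R).symm

instance Coord.pi {κ : Type} [Finite κ] : Coord R (κ → R) where
  ι := κ
  finite_index := inferInstance
  e := Homeomorph.refl _

instance Coord.prod : Coord R (S × T) where
  ι := Coord.ι R S ⊕ Coord.ι R T
  finite_index := inferInstance
  e := (Coord.e.prodCongr Coord.e).trans Homeomorph.sumArrowHomeomorphProdArrow.symm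

/-- The `i`-th coordinate of `x`. -/
def co (x : T) (i : Coord.ι R T) : R := Coord.e x i

@[simp] theorem co_pi {κ : Type} [Finite κ] (x : κ → R) (i : κ) :
    co (R := R) x i = x i := rfl

@[simp] theorem co_inl (p : S × T) (i : Coord.ι R S) :
    co p (Sum.inl i : Coord.ι R S ⊕ Coord.ι R T) = co p.1 i := rfl

@[simp] theorem co_inr (p : S × T) (i : Coord.ι R T) :
    co p (Sum.inr i : Coord.ι R S ⊕ Coord.ι R T) = co p.2 i := rfl

@[simp] theorem co_symm (z : Coord.ι R T → R) (i : Coord.ι R T) :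
    co ((Coord.e (R := R) (T := T)).symm z) i = z i := by
  simp [co]

theorem co_ext {x y : T} (h : ∀ i : Coord.ι R T, co x i = co y i) : x = y :=
  Coord.e.injective (funext h)

theorem forall_index_prod {p : Coord.ι R (S × T) → Prop} :
    (∀ i, p i) ↔ (∀ i : Coord.ι R S, p (Sum.inl i : Coord.ι R S ⊕ Coord.ι R T)) ∧
      ∀ i : Coord.ι R T, p (Sum.inr i : Coord.ι R S ⊕ Coord.ι R T) :=
  Sum.forall

theorem continuous_co (i : Coord.ι R T) : Continuous fun x : T => co x i :=
  (continuous_apply i).comp (Coord.e (R := R) (T := T)).continuous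

theorem continuous_of_co {X : Type*} [TopologicalSpace X] {f : X → T}
    (h : ∀ i : Coord.ι R T, Continuous fun x => co (f x) i) :
    Continuous f := by
  have : Continuous fun x => (Coord.e (R := R) (T := T)) (f x) := continuous_pi h
  exact (Coord.e (R := R) (T := T)).comp_continuous_iff.1 this

variable (R) in
/-- `f` is a coordinate map: every coordinate of `f x` is a fixed coordinate of `x`. -/
def Reidx (f : S → T) : Prop :=
  ∃ τ : Coord.ι R T → Coord.ι R S, ∀ x i, co (f x) i = co x (τ i)

theorem Reidx.continuous {f : S → T} (h : Reidx R f) : Continuous f := by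
  obtain ⟨τ, hτ⟩ := h
  refine continuous_of_co (R := R) fun i => ?_
  simp only [hτ]
  exact continuous_co _

theorem Reidx.fst : Reidx R (Prod.fst : S × T → S) := ⟨Sum.inl, fun _ _ => rfl⟩

theorem Reidx.snd : Reidx R (Prod.snd : S × T → T) := ⟨Sum.inr, fun _ _ => rfl⟩

theorem Reidx.id : Reidx R (fun x : S => x) := ⟨_root_.id, fun _ _ => rfl⟩

theorem Reidx.comp {g : T → V} {f : S → T} (hg : Reidx R g) (hf : Reidx R f) :
    Reidx R (fun x => g (f x)) := by
  obtain ⟨τ, hτ⟩ := hg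
  obtain ⟨τ', hτ'⟩ := hf
  exact ⟨fun i => τ' (τ i), fun x i => by rw [hτ, hτ']⟩

theorem Reidx.prodMk {f : S → T} {g : S → V} (hf : Reidx R f) (hg : Reidx R g) :
    Reidx R (fun x => (f x, g x)) := by
  obtain ⟨τ, hτ⟩ := hf
  obtain ⟨τ', hτ'⟩ := hg
  refine ⟨Sum.elim τ τ', fun x => ?_⟩
  rintro (i | i)
  · exact hτ x i
  · exact hτ' x i

theorem Reidx.co (i : Coord.ι R S) : Reidx R (fun x : S => OpenCore.co x i) :=
  ⟨fun _ => i, fun _ _ => rfl⟩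

theorem Reidx.eval {κ : Type} [Finite κ] (j : κ) : Reidx R (fun x : κ → R => x j) :=
  ⟨fun _ => j, fun _ _ => rfl⟩

theorem Reidx.restrict {κ κ' : Type} [Finite κ] [Finite κ'] (σ : κ' → κ) :
    Reidx R (fun x : κ → R => x ∘ σ) :=
  ⟨σ, fun _ _ => rfl⟩

end Coordinates

/-! ### Definable predicates, maps and families -/

section Definability

variable (L : FirstOrder.Language.{u, v}) (R : Type w) [TopologicalSpace R] [L.Structure R]
  {S : Type w} [TopologicalSpace S] [Coord R S]
  {T : Type w} [TopologicalSpace T] [Coord R T]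
  {V : Type w} [TopologicalSpace V] [Coord R V]

/-- Definable predicates. -/
@[fun_prop]
def DefP (P : T → Prop) : Prop :=
  Def L {z : Coord.ι R T → R | P ((Coord.e (R := R) (T := T)).symm z)}

/-- Definable maps: the graph is definable. -/
@[fun_prop]
def DefF (f : S → T) : Prop := DefP L R fun p : S × T => f p.1 = p.2

variable {L R}

theorem DefP.congr {P Q : T → Prop} (h : DefP L R P) (hPQ : ∀ x, Q x ↔ P x) : DefP L R Q := by
  have : Q = P := funext fun x => propext (hPQ x)
  rwa [this]

@[fun_prop]
theorem DefP.const (p : Prop) : DefP L R fun _ : T => p := by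
  by_cases h : p
  · simp [DefP, h]
  · simp [DefP, h]

@[fun_prop]
theorem DefP.and {P Q : T → Prop} (hP : DefP L R P) (hQ : DefP L R Q) :
    DefP L R fun x => P x ∧ Q x := Definable.inter hP hQ

@[fun_prop]
theorem DefP.or {P Q : T → Prop} (hP : DefP L R P) (hQ : DefP L R Q) :
    DefP L R fun x => P x ∨ Q x := Definable.union hP hQ

@[fun_prop]
theorem DefP.not {P : T → Prop} (hP : DefP L R P) : DefP L R fun x => ¬ P x :=
  Definable.compl hP

@[fun_prop]
theorem DefP.imp {P Q : T → Prop} (hP : DefP L R P) (hQ : DefP L R Q) :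
    DefP L R fun x => P x → Q x :=
  (hP.not.or hQ).congr fun _ => imp_iff_not_or

@[fun_prop]
theorem DefP.forall_index {κ : Type*} [Finite κ] {P : κ → T → Prop}
    (hP : ∀ k, DefP L R (P k)) : DefP L R fun x => ∀ k, P k x := by
  have := definable_iInter_of_finite (A := univ) (L := L) (fun k => hP k)
  unfold DefP Def
  convert this using 1
  ext z
  simp

theorem DefP.comp_reidx {P : T → Prop} (hP : DefP L R P) {f : S → T} (hf : Reidx R f) :
    DefP L R fun x => P (f x) := by
  obtain ⟨τ, hτ⟩ := hf
  have := Definable.preimage_comp τ hP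
  unfold DefP Def
  convert this using 1
  ext z
  have : f ((Coord.e (R := R) (T := S)).symm z) = (Coord.e (R := R) (T := T)).symm (z ∘ τ) :=
    co_ext (R := R) fun i => by rw [hτ]; simp
  simp only [mem_ofPred_eq, mem_preimage, this]

@[fun_prop]
theorem DefP.ex {P : S → T → Prop} (hP : DefP L R fun p : S × T => P p.1 p.2) :
    DefP L R fun x => ∃ y, P x y := by
  have := Definable.exists_of_finite (α := Coord.ι R S) (β := Coord.ι R T) hP
  unfold DefP Def
  convert this using 1
  ext z
  simp only [mem_ofPred_eq]
  exact (Coord.e (R := R) (T := T)).symm.surjective.exists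

@[fun_prop]
theorem DefP.all {P : S → T → Prop} (hP : DefP L R fun p : S × T => P p.1 p.2) :
    DefP L R fun x => ∀ y, P x y :=
  (DefP.ex (P := fun x y => ¬ P x y) hP.not).not.congr fun x => by simp

theorem DefP.eq_coord (i j : Coord.ι R T) : DefP L R fun x : T => co (R := R) x i = co x j := by
  have := Definable.preimage_comp (![i, j] : Fin 2 → Coord.ι R T)
    (Definable.diagonal (L := L) (univ : Set R))
  unfold DefP Def
  convert this using 1
  ext z
  simp

theorem DefF.of_reidx {f : S → T} (hf : Reidx R f) : DefF L R f := by
  obtain ⟨τ, hτ⟩ := hf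
  refine (DefP.forall_index fun i : Coord.ι R T =>
    DefP.eq_coord (T := S × T) (Sum.inl (τ i)) (Sum.inr i)).congr fun p => ?_
  constructor
  · intro h i
    simp only [co_inl, co_inr]
    rw [← h, hτ]
  · intro h
    refine co_ext (R := R) fun i => ?_
    rw [hτ]
    exact h i

-- Only coordinate maps can be substituted directly; a general definable map is substituted by
-- quantifying over its value on the graph.
@[fun_prop]
theorem DefP.comp {P : T → Prop} (hP : DefP L R P) {f : S → T} (hf : DefF L R f) :
    DefP L R fun x => P (f x) := by
  have h : DefP L R fun p : S × T => f p.1 = p.2 ∧ P p.2 :=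
    DefP.and hf (hP.comp_reidx Reidx.snd)
  exact (DefP.ex (P := fun x t => f x = t ∧ P t) h).congr fun x => by simp

@[fun_prop]
theorem DefF.prodMk {f : S → T} {g : S → V} (hf : DefF L R f) (hg : DefF L R g) :
    DefF L R (fun x => (f x, g x)) := by
  have h1 := DefP.comp_reidx (S := S × (T × V)) hf (f := fun p => (p.1, p.2.1))
    (Reidx.fst.prodMk (Reidx.fst.comp Reidx.snd))
  have h2 := DefP.comp_reidx (S := S × (T × V)) hg (f := fun p => (p.1, p.2.2))
    (Reidx.fst.prodMk (Reidx.snd.comp Reidx.snd))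
  exact (h1.and h2).congr fun p => Prod.ext_iff

@[fun_prop]
theorem DefF.comp {g : T → V} {f : S → T} (hg : DefF L R g) (hf : DefF L R f) :
    DefF L R (fun x => g (f x)) := by
  have h1 := DefP.comp_reidx (S := (S × V) × T) hf (f := fun p => (p.1.1, p.2))
    ((Reidx.fst.comp Reidx.fst).prodMk Reidx.snd)
  have h2 := DefP.comp_reidx (S := (S × V) × T) hg (f := fun p => (p.2, p.1.2))
    (Reidx.snd.prodMk (Reidx.snd.comp Reidx.fst))
  exact (DefP.ex (P := fun (p : S × V) t => f p.1 = t ∧ g t = p.2) (h1.and h2)).congr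
    fun p => by simp

@[fun_prop]
theorem DefF.id : DefF L R (fun x : S => x) := DefF.of_reidx Reidx.id

@[fun_prop]
theorem DefF.fst {f : S → T × V} (hf : DefF L R f) : DefF L R fun x => (f x).1 :=
  DefF.comp (DefF.of_reidx Reidx.fst) hf

@[fun_prop]
theorem DefF.snd {f : S → T × V} (hf : DefF L R f) : DefF L R fun x => (f x).2 :=
  DefF.comp (DefF.of_reidx Reidx.snd) hf

@[fun_prop]
theorem DefF.co {f : S → T} (hf : DefF L R f) (i : Coord.ι R T) :
    DefF L R fun x => OpenCore.co (f x) i :=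
  DefF.comp (DefF.of_reidx (Reidx.co i)) hf

theorem DefP.eq_const (a : R) : DefP L R fun x : R => x = a := by
  have := Definable.preimage_comp (fun _ : Fin 1 => (() : Coord.ι R R))
    (Definable.singleton_of_mem (L := L) (mem_univ a))
  exact this

@[fun_prop]
theorem DefF.const (c : T) : DefF L R fun _ : S => c := by
  refine (DefP.forall_index fun i : Coord.ι R T => (DefP.eq_const (OpenCore.co (R := R) c i)).comp_reidx
    ((Reidx.co (R := R) i).comp (Reidx.snd (S := S) (T := T)))).congr fun p => ?_
  exact ⟨fun h i => by rw [← h], fun h => co_ext (R := R) fun i => (h i).symm⟩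

@[fun_prop]
theorem DefP.eq {f g : S → T} (hf : DefF L R f) (hg : DefF L R g) :
    DefP L R fun x => f x = g x :=
  DefP.comp hf (DefF.id.prodMk hg)

/-- Definable families of subsets of `T` with parameter space `S`. -/
def DefFam (L : FirstOrder.Language.{u, v}) (R : Type w) [TopologicalSpace R] [L.Structure R]
    {S : Type w} [TopologicalSpace S] [Coord R S] {T : Type w} [TopologicalSpace T] [Coord R T]
    (F : S → Set T) : Prop :=
  DefP L R fun p : S × T => p.2 ∈ F p.1

theorem DefFam.mem {F : S → Set T} (hF : DefFam L R F) {f : V → S} {g : V → T}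
    (hf : DefF L R f) (hg : DefF L R g) : DefP L R fun x => g x ∈ F (f x) :=
  DefP.comp hF (hf.prodMk hg)

theorem DefFam.mem₂ {S' : Type w} [TopologicalSpace S'] [Coord R S'] {F : S → S' → Set T}
    (hF : DefFam L R fun p : S × S' => F p.1 p.2) {f : V → S} {g : V → S'} {h : V → T}
    (hf : DefF L R f) (hg : DefF L R g) (hh : DefF L R h) :
    DefP L R fun x => h x ∈ F (f x) (g x) :=
  DefP.comp hF ((hf.prodMk hg).prodMk hh)

theorem DefP.mem {A : Set T} (hA : DefP L R fun x => x ∈ A) {f : S → T} (hf : DefF L R f) :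
    DefP L R fun x => f x ∈ A :=
  hA.comp hf

end Definability

/-- The standing hypotheses: a definably complete expansion of an ordered group with local uniform
finiteness. -/
class Tame (L : FirstOrder.Language.{u, v}) (R : Type w) [AddCommGroup R] [LinearOrder R]
    [TopologicalSpace R] [L.Structure R] : Prop where
  expands : ExpandsOrderedGroup L R
  complete : DefinablyComplete L R
  luf : LUF₂ L R

/-! ### Definability of the order and the group operations -/

section Order

variable {L : FirstOrder.Language.{u, v}} {R : Type w} [AddCommGroup R] [LinearOrder R]
  [TopologicalSpace R] [L.Structure R] [Tame L R]
  {S : Type w} [TopologicalSpace S] [Coord R S]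
  {T : Type w} [TopologicalSpace T] [Coord R T]

@[fun_prop]
theorem DefP.lt {f g : S → R} (hf : DefF L R f) (hg : DefF L R g) :
    DefP L R fun x => f x < g x := by
  have h : DefP L R fun x : Fin 2 → R => x 0 < x 1 := (Tame.expands (L := L) (R := R)).lt_definable
  have h2 : DefP L R fun p : R × R => p.1 < p.2 :=
    h.comp_reidx (f := fun p : R × R => ![p.1, p.2])
      ⟨![Sum.inl (), Sum.inr ()], fun x (i : Fin 2) => by fin_cases i <;> rfl⟩
  exact h2.comp (hf.prodMk hg)

@[fun_prop]
theorem DefP.le {f g : S → R} (hf : DefF L R f) (hg : DefF L R g) :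
    DefP L R fun x => f x ≤ g x :=
  (DefP.lt hg hf).not.congr fun _ => not_lt.symm

@[fun_prop]
theorem DefF.add {f g : S → R} (hf : DefF L R f) (hg : DefF L R g) :
    DefF L R fun x => f x + g x := by
  have h : DefP L R fun x : Fin 3 → R => x 0 + x 1 = x 2 :=
    (Tame.expands (L := L) (R := R)).add_definable
  have h2 : DefF L R fun p : R × R => p.1 + p.2 :=
    h.comp_reidx (f := fun p : (R × R) × R => ![p.1.1, p.1.2, p.2])
      ⟨![Sum.inl (Sum.inl ()), Sum.inl (Sum.inr ()), Sum.inr ()],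
        fun x (i : Fin 3) => by fin_cases i <;> rfl⟩
  exact h2.comp (hf.prodMk hg)

@[fun_prop]
theorem DefF.neg {f : S → R} (hf : DefF L R f) : DefF L R fun x => -f x := by
  have h : DefP L R fun p : S × R => f p.1 + p.2 = 0 :=
    DefP.eq ((hf.comp DefF.id.fst).add DefF.id.snd) (DefF.const 0)
  exact h.congr fun p => by rw [neg_eq_iff_add_eq_zero]

@[fun_prop]
theorem DefF.sub {f g : S → R} (hf : DefF L R f) (hg : DefF L R g) :
    DefF L R fun x => f x - g x := by
  simpa only [sub_eq_add_neg] using hf.add hg.neg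

@[fun_prop]
theorem DefF.abs {f : S → R} (hf : DefF L R f) : DefF L R fun x => |f x| := by
  have h : DefP L R fun p : S × R =>
      (f p.1 = p.2 ∨ -f p.1 = p.2) ∧ f p.1 ≤ p.2 ∧ -f p.1 ≤ p.2 := by fun_prop
  refine h.congr fun p => ⟨?_, ?_⟩
  · rintro h
    rw [← h]
    exact ⟨(abs_choice (f p.1)).imp Eq.symm Eq.symm, le_abs_self _, neg_le_abs _⟩
  · rintro ⟨h | h, h1, h2⟩
    · rw [← h] at h2 ⊢
      exact sup_eq_left.2 h2
    · rw [← h] at h1 ⊢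
      exact sup_eq_right.2 h1

/-- The points `x` and `y` differ by less than `ε` in every coordinate. -/
def near (x y : T) (ε : R) : Prop := ∀ i : Coord.ι R T, |co x i - co y i| < ε

@[fun_prop]
theorem DefP.near {f g : S → T} {h : S → R} (hf : DefF L R f) (hg : DefF L R g)
    (hh : DefF L R h) : DefP L R fun x => OpenCore.near (f x) (g x) (h x) := by
  unfold OpenCore.near
  fun_prop

end Order

/-! ### The topology in terms of coordinatewise distance -/

section Nhds

variable {R : Type w} [AddCommGroup R] [LinearOrder R] [IsOrderedAddMonoid R]
  [TopologicalSpace R]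
  {S : Type w} [TopologicalSpace S] [Coord R S]
  {T : Type w} [TopologicalSpace T] [Coord R T]

theorem near_self (x : T) {ε : R} (hε : 0 < ε) : near x x ε := fun i => by simpa using hε

theorem near.symm {x y : T} {ε : R} (h : near x y ε) : near y x ε := fun i => by
  rw [abs_sub_comm]
  exact h i

theorem near.mono {x y : T} {ε δ : R} (h : near x y ε) (hεδ : ε ≤ δ) : near x y δ :=
  fun i => (h i).trans_le hεδ

theorem near_self_iff {x y ε : R} : near x y ε ↔ |x - y| < ε :=
  ⟨fun h => h (), fun h _ => h⟩

theorem near_prod_iff {p q : S × T} {ε : R} :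
    near p q ε ↔ near p.1 q.1 ε ∧ near p.2 q.2 ε :=
  Sum.forall

theorem exists_add_self_le [DenselyOrdered R] {s : R} (hs : 0 < s) : ∃ h, 0 < h ∧ h + h ≤ s := by
  obtain ⟨m, hm, hms⟩ := exists_between hs
  refine ⟨min m (s - m), lt_min hm (sub_pos.2 hms), ?_⟩
  calc min m (s - m) + min m (s - m) ≤ m + (s - m) :=
        add_le_add (min_le_left _ _) (min_le_right _ _)
    _ = s := by abel

variable [OrderTopology R]

theorem isOpen_near (x : T) (ε : R) : IsOpen {y : T | near y x ε} := by
  have : {y : T | near y x ε} = ⋂ i : Coord.ι R T, {y : T | |co y i - co x i| < ε} := by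
    ext y
    simp [near]
  rw [this]
  refine isOpen_iInter_of_finite fun i => ?_
  exact isOpen_lt (((continuous_co i).sub continuous_const).abs) continuous_const

variable [DenselyOrdered R] [Nontrivial R]

theorem exists_near_subset {x : T} {s : Set T} (hs : s ∈ 𝓝 x) :
    ∃ ε : R, 0 < ε ∧ ∀ y, near y x ε → y ∈ s := by
  rw [(Coord.e (R := R) (T := T)).isInducing.nhds_eq_comap, Filter.mem_comap] at hs
  obtain ⟨t, ht, hts⟩ := hs
  rw [nhds_pi, Filter.mem_pi] at ht
  obtain ⟨I, -, t', ht', htt'⟩ := ht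
  have h1 : ∀ i, ∃ ε > 0, ∀ z, |z - co (R := R) x i| < ε → z ∈ t' i := fun i => by
    obtain ⟨ε, hε, h⟩ := (nhds_basis_abs_sub_lt (co (R := R) x i)).mem_iff.1 (ht' i)
    exact ⟨ε, hε, fun z hz => h hz⟩
  choose δ hδ h1 using h1
  have h2 : ∀ᶠ ε in 𝓝[>] (0 : R), 0 < ε ∧ ∀ i, ε < δ i := by
    refine Filter.Eventually.and self_mem_nhdsWithin ?_
    rw [Filter.eventually_all]
    exact fun i => nhdsWithin_le_nhds (Iio_mem_nhds (hδ i))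
  obtain ⟨ε, hε, h2⟩ := h2.exists
  refine ⟨ε, hε, fun y hy => hts (htt' fun i _ => h1 i _ ((hy i).trans (h2 i)))⟩

theorem mem_nhds_iff_near {x : T} {s : Set T} :
    s ∈ 𝓝 x ↔ ∃ ε : R, 0 < ε ∧ ∀ y, near y x ε → y ∈ s := by
  refine ⟨exists_near_subset, ?_⟩
  rintro ⟨ε, hε, h⟩
  exact Filter.mem_of_superset ((isOpen_near x ε).mem_nhds (near_self x hε)) h

theorem mem_closure_iff_near {x : T} {s : Set T} :
    x ∈ closure s ↔ ∀ ε : R, 0 < ε → ∃ y, near y x ε ∧ y ∈ s := by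
  rw [mem_closure_iff_nhds]
  constructor
  · intro h ε hε
    exact h _ ((isOpen_near x ε).mem_nhds (near_self x hε))
  · intro h t ht
    obtain ⟨ε, hε, h'⟩ := exists_near_subset (R := R) ht
    obtain ⟨y, hy, hys⟩ := h ε hε
    exact ⟨y, h' y hy, hys⟩

theorem mem_interior_iff_near {x : T} {s : Set T} :
    x ∈ interior s ↔ ∃ ε : R, 0 < ε ∧ ∀ y, near y x ε → y ∈ s := by
  rw [mem_interior_iff_mem_nhds, mem_nhds_iff_near (R := R)]

variable {L : FirstOrder.Language.{u, v}} [L.Structure R] [Tame L R]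

theorem DefP.closure {A : Set T} (hA : DefP L R fun x => x ∈ A) :
    DefP L R fun x => x ∈ _root_.closure A := by
  -- Kept general in the map substituted, so that `fun_prop` can use it under quantifiers.
  have h := @hA.mem
  have : DefP L R fun x : T => ∀ ε : R, 0 < ε → ∃ y, OpenCore.near y x ε ∧ y ∈ A := by
    fun_prop
  exact this.congr fun p => mem_closure_iff_near

end Nhds

/-! ### Definable compactness -/

variable {L : FirstOrder.Language.{u, v}} {R : Type w} [AddCommGroup R] [LinearOrder R]
  [IsOrderedAddMonoid R] [DenselyOrdered R] [Nontrivial R]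
  [TopologicalSpace R] [OrderTopology R] [L.Structure R] [Tame L R]
  {S : Type w} [TopologicalSpace S] [Coord R S]
  {T : Type w} [TopologicalSpace T] [Coord R T]

theorem exists_isLUB_of_defP {A : Set R} (hA : DefP L R fun x => x ∈ A) (hne : A.Nonempty)
    (hb : BddAbove A) : ∃ a, IsLUB A a := by
  refine (Tame.complete (L := L) (R := R)).exists_isLUB A ?_ hne hb
  exact Definable.preimage_comp (fun _ : Unit => (0 : Fin 1)) hA

theorem exists_isGLB_of_defP {A : Set R} (hA : DefP L R fun x => x ∈ A) (hne : A.Nonempty)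
    (hb : BddBelow A) : ∃ a, IsGLB A a := by
  refine (Tame.complete (L := L) (R := R)).exists_isGLB A ?_ hne hb
  exact Definable.preimage_comp (fun _ : Unit => (0 : Fin 1)) hA

/-- A definable chain of nonempty, uniformly bounded subsets of `R` has a common adherent point. -/
theorem exists_mem_closure_of_chain {I : Set S} (hI : DefP L R fun i => i ∈ I) (hIne : I.Nonempty)
    {F : S → Set R} (hF : DefFam L R F) (hne : ∀ i ∈ I, (F i).Nonempty)
    (hchain : ∀ i ∈ I, ∀ j ∈ I, F i ⊆ F j ∨ F j ⊆ F i) {M : R}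
    (hM : ∀ i ∈ I, ∀ y ∈ F i, |y| ≤ M) : ∃ y, ∀ i ∈ I, y ∈ closure (F i) := by
  -- The adherent point is the supremum of the lower bounds of members of the chain, a kind of limit
  -- inferior of their infima.
  set G : Set R := {y | ∃ i, i ∈ I ∧ ∀ z, z ∈ F i → y ≤ z} with hG
  have hGdef : DefP L R fun y => y ∈ G := by
    have h1 := @hF.mem
    have h2 := @hI.mem
    simp only [hG, mem_ofPred_eq]
    fun_prop
  have hGne : G.Nonempty := by
    obtain ⟨i, hi⟩ := hIne
    exact ⟨-M, i, hi, fun z hz => (abs_le.1 (hM i hi z hz)).1⟩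
  have hGb : BddAbove G := by
    refine ⟨M, ?_⟩
    rintro y ⟨i, hi, h⟩
    obtain ⟨z, hz⟩ := hne i hi
    exact (h z hz).trans (abs_le.1 (hM i hi z hz)).2
  obtain ⟨y, hy⟩ := exists_isLUB_of_defP hGdef hGne hGb
  refine ⟨y, fun i hi => (mem_closure_iff_near (R := R)).2 fun ε hε => ?_⟩
  obtain ⟨g, ⟨j, hj, hgj⟩, hyg⟩ := (lt_isLUB_iff hy).1 (sub_lt_self y hε)
  obtain ⟨k, hk, hki, hgk⟩ : ∃ k ∈ I, F k ⊆ F i ∧ ∀ z, z ∈ F k → g ≤ z := by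
    rcases hchain i hi j hj with h | h
    · exact ⟨i, hi, Subset.rfl, fun z hz => hgj z (h hz)⟩
    · exact ⟨j, hj, h, hgj⟩
  obtain ⟨z, hz, hzy⟩ : ∃ z ∈ F k, z < y + ε := by
    by_contra! hcon
    exact (lt_add_of_pos_right y hε).not_ge (hy.1 ⟨k, hk, hcon⟩)
  refine ⟨z, near_self_iff.2 (abs_sub_lt_iff.2 ⟨?_, ?_⟩), hki hz⟩
  · rwa [sub_lt_iff_lt_add']
  · rw [sub_lt_comm]
    exact hyg.trans_le (hgk z hz)

variable (R) in
/-- Bounded sets. -/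
def Bdd (A : Set T) : Prop := ∃ M : R, ∀ x ∈ A, ∀ i : Coord.ι R T, |co x i| ≤ M

theorem Bdd.mono {A B : Set T} (hB : Bdd R B) (h : A ⊆ B) : Bdd R A :=
  hB.imp fun _ hM x hx => hM x (h hx)

theorem Bdd.inter_left {A B : Set T} (hA : Bdd R A) : Bdd R (A ∩ B) := hA.mono inter_subset_left

theorem Bdd.union {A B : Set T} (hA : Bdd R A) (hB : Bdd R B) : Bdd R (A ∪ B) := by
  obtain ⟨M, hM⟩ := hA
  obtain ⟨N, hN⟩ := hB
  refine ⟨max M N, ?_⟩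
  rintro x (hx | hx) i
  · exact (hM x hx i).trans (le_max_left _ _)
  · exact (hN x hx i).trans (le_max_right _ _)

/-- A definable family of nonempty, uniformly bounded subsets of `T` that decreases as the parameter
tends to `0` has a common adherent point. -/
theorem exists_mem_closure_of_decreasing {F : R → Set T} (hF : DefFam L R F)
    (hne : ∀ ε, 0 < ε → (F ε).Nonempty) (hmono : ∀ ε δ, 0 < ε → ε ≤ δ → F ε ⊆ F δ) {M : R}
    (hM : ∀ ε, 0 < ε → ∀ x ∈ F ε, ∀ i : Coord.ι R T, |co x i| ≤ M) :
    ∃ y, ∀ ε, 0 < ε → y ∈ closure (F ε) := by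
  classical
  -- The limit point is built one coordinate at a time: its coordinates in `J` are approximated by
  -- points of every `F ε`. For a new coordinate `j`, the values at `j` of those approximating
  -- points form a bounded chain in `R`.
  have key : ∀ J : Set (Coord.ι R T), J.Finite → ∃ x : T, ∀ ε : R, 0 < ε →
      ∃ z ∈ F ε, ∀ i ∈ J, |co z i - co (R := R) x i| < ε := by
    intro J hJ
    induction J, hJ using Set.Finite.induction_on with
    | empty =>
      obtain ⟨a, ha⟩ := exists_gt (0 : R)
      obtain ⟨x, -⟩ := hne a ha
      exact ⟨x, fun ε hε => (hne ε hε).imp fun z hz => ⟨hz, by simp⟩⟩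
    | @insert j J hj _ ih =>
      obtain ⟨x, hx⟩ := ih
      obtain ⟨y, hy⟩ := exists_mem_closure_of_chain (S := R) (I := Ioi 0)
        (F := fun ε => {y | ∃ z, z ∈ F ε ∧ (∀ i : J, |co z i - co (R := R) x i| < ε) ∧
          co (R := R) z j = y}) (M := M) (L := L)
        (by simp only [mem_Ioi]; fun_prop)
        nonempty_Ioi
        (by
          have h1 := @hF.mem
          unfold DefFam
          simp only [mem_ofPred_eq]
          fun_prop)
        (by
          intro ε hε
          obtain ⟨z, hz, h⟩ := hx ε hε
          exact ⟨_, z, hz, fun i => h i i.2, rfl⟩)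
        (by
          intro ε hε δ hδ
          have main : ∀ ε δ : R, 0 < ε → ε ≤ δ →
              {y | ∃ z, z ∈ F ε ∧ (∀ i : J, |co z i - co (R := R) x i| < ε) ∧
                co (R := R) z j = y} ⊆
              {y | ∃ z, z ∈ F δ ∧ (∀ i : J, |co z i - co (R := R) x i| < δ) ∧
                co (R := R) z j = y} := by
            rintro ε δ hε hεδ y ⟨z, hz, h, hzy⟩
            exact ⟨z, hmono ε δ hε hεδ hz, fun i => (h i).trans_le hεδ, hzy⟩
          exact (le_total ε δ).imp (main ε δ hε) (main δ ε hδ))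
        (by
          rintro ε hε y ⟨z, hz, -, rfl⟩
          exact hM ε hε z hz j)
      refine ⟨(Coord.e (R := R) (T := T)).symm (Function.update (fun i => co x i) j y),
        fun ε hε => ?_⟩
      obtain ⟨y', hy', z, hz, h, rfl⟩ := (mem_closure_iff_near (R := R)).1 (hy ε hε) ε hε
      refine ⟨z, hz, fun i hi => ?_⟩
      rw [co_symm]
      by_cases hij : i = j
      · subst hij
        simpa using near_self_iff.1 hy'
      · rw [Function.update_of_ne hij]
        exact h ⟨i, hi.resolve_left hij⟩
  obtain ⟨x, hx⟩ := key univ finite_univ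
  refine ⟨x, fun ε hε => (mem_closure_iff_near (R := R)).2 fun δ hδ => ?_⟩
  obtain ⟨z, hz, h⟩ := hx (min ε δ) (lt_min hε hδ)
  exact ⟨z, fun i => (h i trivial).trans_le (min_le_right _ _),
    hmono _ _ (lt_min hε hδ) (min_le_left _ _) hz⟩

variable (L R) in
/-- Closed, bounded, definable sets. -/
structure IsCB (K : Set T) : Prop where
  isClosed : IsClosed K
  bdd : Bdd R K
  defn : DefP L R fun x => x ∈ K

/-- Over shrinking neighborhoods of an adherent point `x` of the projection, the second coordinates
of points of `K` form a bounded decreasing family. A common adherent point `y` puts `(x, y)` in the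
closure of `K`. -/
theorem IsCB.isClosed_image_fst {K : Set (S × T)} (hK : IsCB L R K) :
    IsClosed (Prod.fst '' K) := by
  refine isClosed_of_closure_subset fun x hx => ?_
  rw [mem_closure_iff_near (R := R)] at hx
  obtain ⟨M, hM⟩ := hK.bdd
  obtain ⟨y, hy⟩ := exists_mem_closure_of_decreasing (L := L) (R := R) (M := M)
    (F := fun ε => {y : T | ∃ x', near x' x ε ∧ (x', y) ∈ K})
    (by
      have h1 := @hK.defn.mem
      unfold DefFam
      simp only [mem_ofPred_eq]
      fun_prop)
    (by
      intro ε hε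
      obtain ⟨x', hx', p, hp, rfl⟩ := hx ε hε
      exact ⟨p.2, p.1, hx', hp⟩)
    (by
      rintro ε δ - hεδ y ⟨x', hx', h⟩
      exact ⟨x', hx'.mono hεδ, h⟩)
    (by
      rintro ε - y ⟨x', -, h⟩ i
      exact hM _ h (Sum.inr i))
  refine ⟨(x, y), ?_, rfl⟩
  rw [← hK.isClosed.closure_eq, mem_closure_iff_near (R := R)]
  intro ε hε
  obtain ⟨y', hy', x', hx', h⟩ := (mem_closure_iff_near (R := R)).1 (hy ε hε) ε hε
  exact ⟨(x', y'), near_prod_iff.2 ⟨hx', hy'⟩, h⟩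

/-- The image is the first projection of the transposed graph of `f` over `K`. That graph is bounded
because `f` only copies coordinates. -/
theorem IsCB.image {K : Set S} (hK : IsCB L R K) {f : S → T} (hf : Reidx R f) :
    IsCB L R (f '' K) := by
  have hdef : DefP L R fun p : T × S => f p.2 = p.1 ∧ p.2 ∈ K := by
    have h1 := @hK.defn.mem
    have h2 : DefF L R f := DefF.of_reidx hf
    fun_prop
  have himg : f '' K = Prod.fst '' {p : T × S | f p.2 = p.1 ∧ p.2 ∈ K} := by
    ext t
    constructor
    · rintro ⟨x, hx, rfl⟩
      exact ⟨(f x, x), ⟨rfl, hx⟩, rfl⟩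
    · rintro ⟨⟨t, x⟩, ⟨h, hx⟩, rfl⟩
      exact ⟨x, hx, h⟩
  obtain ⟨M, hM⟩ := hK.bdd
  obtain ⟨τ, hτ⟩ := id hf
  refine ⟨?_, ⟨M, ?_⟩, ?_⟩
  · have hT2 : T2Space T := (Coord.e (R := R) (T := T)).isEmbedding.t2Space
    rw [himg]
    refine IsCB.isClosed_image_fst (L := L) (R := R) ⟨?_, ⟨M, ?_⟩, hdef⟩
    · exact (isClosed_eq (hf.continuous.comp continuous_snd) continuous_fst).inter
        (hK.isClosed.preimage continuous_snd)
    · rintro ⟨t, x⟩ ⟨h, hx⟩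
      obtain rfl : f x = t := h
      rw [forall_index_prod]
      refine ⟨fun i => ?_, fun i => hM x hx i⟩
      rw [co_inl, hτ]
      exact hM x hx _
  · rintro _ ⟨x, hx, rfl⟩ i
    rw [hτ]
    exact hM x hx _
  · refine (DefP.ex (P := fun t x => f x = t ∧ x ∈ K) hdef).congr fun t => ?_
    simp [and_comm]

/-! ### Families of closed bounded sets and their unions -/

variable (L) in
/-- A definable family of closed bounded sets `F r s`, `r, s > 0`, increasing in `r` and decreasing
in `s`. -/
structure DFam (F : R → R → Set T) : Prop where
  defn : DefFam L R fun p : R × R => F p.1 p.2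
  isClosed : ∀ r s, 0 < r → 0 < s → IsClosed (F r s)
  bdd : ∀ r s, 0 < r → 0 < s → Bdd R (F r s)
  mono : ∀ r r' s, 0 < r → 0 < s → r ≤ r' → F r s ⊆ F r' s
  anti : ∀ r s s', 0 < r → 0 < s → s ≤ s' → F r s' ⊆ F r s

/-- The union of the sets `F r s`, `r, s > 0`. -/
def uni (F : R → R → Set T) : Set T := {x | ∃ r s, 0 < r ∧ 0 < s ∧ x ∈ F r s}

variable (L R) in
/-- Unions of families as in `DFam`. -/
def DSig (X : Set T) : Prop := ∃ F : R → R → Set T, DFam L F ∧ X = uni F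

theorem subset_uni (F : R → R → Set T) {r s : R} (hr : 0 < r) (hs : 0 < s) : F r s ⊆ uni F :=
  fun _ hx => ⟨r, s, hr, hs, hx⟩

namespace DFam

variable {F G : R → R → Set T}

theorem subset (hF : DFam L F) {r r' s s' : R} (hr : 0 < r) (hrr' : r ≤ r') (hs : 0 < s')
    (hss' : s' ≤ s) : F r s ⊆ F r' s' :=
  (hF.anti r s' s hr hs hss').trans (hF.mono r r' s' hr hs hrr')

theorem isCB (hF : DFam L F) {r s : R} (hr : 0 < r) (hs : 0 < s) : IsCB L R (F r s) where
  isClosed := hF.isClosed r s hr hs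
  bdd := hF.bdd r s hr hs
  defn := by
    have h := @hF.defn.mem₂
    fun_prop

theorem defP_uni (hF : DFam L F) : DefP L R fun x => x ∈ uni F := by
  have h := @hF.defn.mem₂
  simp only [uni, mem_ofPred_eq]
  fun_prop

theorem inter (hF : DFam L F) (hG : DFam L G) : DFam L fun r s => F r s ∩ G r s where
  defn := by
    have h := @hF.defn.mem₂
    have h' := @hG.defn.mem₂
    simp only [DefFam, mem_inter_iff]
    fun_prop
  isClosed r s hr hs := (hF.isClosed r s hr hs).inter (hG.isClosed r s hr hs)
  bdd r s hr hs := (hF.bdd r s hr hs).inter_left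
  mono r r' s hr hs h := inter_subset_inter (hF.mono r r' s hr hs h) (hG.mono r r' s hr hs h)
  anti r s s' hr hs h := inter_subset_inter (hF.anti r s s' hr hs h) (hG.anti r s s' hr hs h)

theorem union (hF : DFam L F) (hG : DFam L G) : DFam L fun r s => F r s ∪ G r s where
  defn := by
    have h := @hF.defn.mem₂
    have h' := @hG.defn.mem₂
    simp only [DefFam, mem_union]
    fun_prop
  isClosed r s hr hs := (hF.isClosed r s hr hs).union (hG.isClosed r s hr hs)
  bdd r s hr hs := (hF.bdd r s hr hs).union (hG.bdd r s hr hs)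
  mono r r' s hr hs h := union_subset_union (hF.mono r r' s hr hs h) (hG.mono r r' s hr hs h)
  anti r s s' hr hs h := union_subset_union (hF.anti r s s' hr hs h) (hG.anti r s s' hr hs h)

theorem uni_inter (hF : DFam L F) (hG : DFam L G) :
    (uni fun r s => F r s ∩ G r s) = uni F ∩ uni G := by
  ext x
  constructor
  · rintro ⟨r, s, hr, hs, h⟩
    exact ⟨⟨r, s, hr, hs, h.1⟩, ⟨r, s, hr, hs, h.2⟩⟩
  · rintro ⟨⟨r, s, hr, hs, h⟩, ⟨r', s', hr', hs', h'⟩⟩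
    exact ⟨max r r', min s s', lt_max_of_lt_left hr, lt_min hs hs',
      hF.subset hr (le_max_left _ _) (lt_min hs hs') (min_le_left _ _) h,
      hG.subset hr' (le_max_right _ _) (lt_min hs hs') (min_le_right _ _) h'⟩

theorem uni_union : (uni fun r s => F r s ∪ G r s) = uni F ∪ uni G := by
  ext x
  constructor
  · rintro ⟨r, s, hr, hs, h | h⟩
    · exact Or.inl ⟨r, s, hr, hs, h⟩
    · exact Or.inr ⟨r, s, hr, hs, h⟩
  · rintro (⟨r, s, hr, hs, h⟩ | ⟨r, s, hr, hs, h⟩)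
    · exact ⟨r, s, hr, hs, Or.inl h⟩
    · exact ⟨r, s, hr, hs, Or.inr h⟩

theorem image {F : R → R → Set S} (hF : DFam L F) {f : S → T} (hf : Reidx R f) :
    DFam L fun r s => f '' F r s where
  defn := by
    have h := @hF.defn.mem₂
    have h2 : DefF L R f := DefF.of_reidx hf
    simp only [DefFam, mem_image]
    fun_prop
  isClosed r s hr hs := ((hF.isCB hr hs).image hf).isClosed
  bdd r s hr hs := ((hF.isCB hr hs).image hf).bdd
  mono r r' s hr hs h := image_mono (hF.mono r r' s hr hs h)
  anti r s s' hr hs h := image_mono (hF.anti r s s' hr hs h)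

theorem uni_image {F : R → R → Set S} {f : S → T} :
    (uni fun r s => f '' F r s) = f '' uni F := by
  ext x
  constructor
  · rintro ⟨r, s, hr, hs, y, hy, rfl⟩
    exact ⟨y, ⟨r, s, hr, hs, hy⟩, rfl⟩
  · rintro ⟨y, ⟨r, s, hr, hs, hy⟩, rfl⟩
    exact ⟨r, s, hr, hs, y, hy, rfl⟩

theorem fiber {F : R → R → Set (S × T)} (hF : DFam L F) (x : S) :
    DFam L fun r s => {y | (x, y) ∈ F r s} where
  defn := by
    have h := @hF.defn.mem₂
    simp only [DefFam, mem_ofPred_eq]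
    fun_prop
  isClosed r s hr hs := (hF.isClosed r s hr hs).preimage (by fun_prop)
  bdd r s hr hs := by
    obtain ⟨M, hM⟩ := hF.bdd r s hr hs
    exact ⟨M, fun y hy i => hM _ hy (Sum.inr i)⟩
  mono r r' s hr hs h _ hy := hF.mono r r' s hr hs h hy
  anti r s s' hr hs h _ hy := hF.anti r s s' hr hs h hy

end DFam

/-- The points all of whose coordinates have absolute value at most `r`. -/
def cube (T : Type w) [TopologicalSpace T] [Coord R T] (r : R) : Set T :=
  {x | ∀ i : Coord.ι R T, |co x i| ≤ r}

theorem isClosed_cube (r : R) : IsClosed (cube T r) := by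
  have : cube T r = ⋂ i : Coord.ι R T, {y : T | |co y i| ≤ r} := by
    ext y
    simp [cube]
  rw [this]
  exact isClosed_iInter fun i => isClosed_le ((continuous_co i).abs) continuous_const

theorem bdd_cube (r : R) : Bdd R (cube T r) := ⟨r, fun _ hx => hx⟩

theorem cube_mono {r r' : R} (h : r ≤ r') : cube T r ⊆ cube T r' := fun _ hx i => (hx i).trans h

theorem exists_mem_cube (x : T) : ∃ r : R, 0 < r ∧ x ∈ cube T r := by
  obtain ⟨M, hM⟩ := (finite_range fun i : Coord.ι R T => |co x i|).bddAbove
  obtain ⟨a, ha⟩ := exists_gt (0 : R)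
  exact ⟨max a M, lt_max_of_lt_left ha, fun i => (hM ⟨i, rfl⟩).trans (le_max_right _ _)⟩

theorem defFam_cube : DefFam L R fun r : R => cube T r := by
  simp only [DefFam, cube, mem_ofPred_eq]
  fun_prop

theorem DFam.of_isClosed {C : Set T} (hC : IsClosed C) (hdef : DefP L R fun x => x ∈ C) :
    DFam L fun r (_ : R) => C ∩ cube T r where
  defn := by
    have h1 := @hdef.mem
    have h2 := @(defFam_cube (L := L) (R := R) (T := T)).mem
    simp only [DefFam, mem_inter_iff]
    fun_prop
  isClosed r s hr hs := hC.inter (isClosed_cube r)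
  bdd r s hr hs := (bdd_cube r).mono inter_subset_right
  mono r r' s hr hs h := inter_subset_inter_right _ (cube_mono h)
  anti r s s' hr hs h := Subset.rfl

theorem uni_inter_cube (C : Set T) : (uni fun r (_ : R) => C ∩ cube T r) = C := by
  ext x
  constructor
  · rintro ⟨r, s, hr, hs, h⟩
    exact h.1
  · intro hx
    obtain ⟨r, hr, h⟩ := exists_mem_cube (R := R) x
    exact ⟨r, r, hr, hr, hx, h⟩

/-- Inner approximations of an open set. -/
def inner (U : Set T) (r s : R) : Set T := {x | ∀ y, near y x s → y ∈ U} ∩ cube T r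

theorem DFam.of_isOpen {U : Set T} (hdef : DefP L R fun x => x ∈ U) :
    DFam L (inner (R := R) U) where
  defn := by
    have h1 := @hdef.mem
    have h2 := @(defFam_cube (L := L) (R := R) (T := T)).mem
    simp only [DefFam, inner, mem_inter_iff, mem_ofPred_eq]
    fun_prop
  isClosed r s hr hs := by
    refine IsClosed.inter ?_ (isClosed_cube r)
    have : {x : T | ∀ y, near y x s → y ∈ U} = (⋃ y ∈ Uᶜ, {x : T | near x y s})ᶜ := by
      ext x
      simp only [mem_ofPred_eq, mem_compl_iff, mem_iUnion, not_exists]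
      exact ⟨fun h y hy hxy => hy (h y hxy.symm), fun h y hxy => by_contra fun hy => h y hy hxy.symm⟩
    rw [this, isClosed_compl_iff]
    exact isOpen_biUnion fun y _ => isOpen_near y s
  bdd r s hr hs := (bdd_cube r).mono inter_subset_right
  mono r r' s hr hs h := inter_subset_inter_right _ (cube_mono h)
  anti r s s' hr hs h := inter_subset_inter_left _ fun x hx y hy => hx y (hy.mono h)

theorem uni_inner {U : Set T} (hU : IsOpen U) : uni (inner (R := R) U) = U := by
  ext x
  constructor
  · rintro ⟨r, s, hr, hs, h⟩
    exact h.1 x (near_self x hs)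
  · intro hx
    obtain ⟨r, hr, h⟩ := exists_mem_cube (R := R) x
    obtain ⟨s, hs, h'⟩ := exists_near_subset (R := R) (hU.mem_nhds hx)
    exact ⟨r, s, hr, hs, h', h⟩

namespace DSig

variable {X Y : Set T}

theorem defP (hX : DSig L R X) : DefP L R fun x => x ∈ X := by
  obtain ⟨F, hF, rfl⟩ := hX
  exact hF.defP_uni

theorem inter (hX : DSig L R X) (hY : DSig L R Y) : DSig L R (X ∩ Y) := by
  obtain ⟨F, hF, rfl⟩ := hX
  obtain ⟨G, hG, rfl⟩ := hY
  exact ⟨_, hF.inter hG, (hF.uni_inter hG).symm⟩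

theorem union (hX : DSig L R X) (hY : DSig L R Y) : DSig L R (X ∪ Y) := by
  obtain ⟨F, hF, rfl⟩ := hX
  obtain ⟨G, hG, rfl⟩ := hY
  exact ⟨_, hF.union hG, DFam.uni_union.symm⟩

theorem image {X : Set S} (hX : DSig L R X) {f : S → T} (hf : Reidx R f) :
    DSig L R (f '' X) := by
  obtain ⟨F, hF, rfl⟩ := hX
  exact ⟨_, hF.image hf, DFam.uni_image.symm⟩

theorem of_isClosed (hX : IsClosed X) (hdef : DefP L R fun x => x ∈ X) : DSig L R X :=
  ⟨_, DFam.of_isClosed hX hdef, (uni_inter_cube X).symm⟩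

theorem of_isOpen (hX : IsOpen X) (hdef : DefP L R fun x => x ∈ X) : DSig L R X :=
  ⟨_, DFam.of_isOpen hdef, (uni_inner hX).symm⟩

end DSig

theorem IsDSigma.dSig {n : ℕ} {X : Set (Fin n → R)} (hX : IsDSigma L X) : DSig L R X := by
  obtain ⟨-, D, hD, rfl⟩ := hX
  refine ⟨fiber₂ D, ⟨?_, ?_, ?_, hD.mono, hD.anti⟩, rfl⟩
  · have h : DefP L R fun x : Fin (2 + n) → R => x ∈ D := hD.definable
    refine h.comp_reidx (f := fun p : (R × R) × (Fin n → R) => Fin.append ![p.1.1, p.1.2] p.2)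
      ⟨Fin.append ![Sum.inl (Sum.inl ()), Sum.inl (Sum.inr ())] (fun i => Sum.inr i),
        fun p (i : Fin (2 + n)) => ?_⟩
    refine Fin.addCases (fun i => ?_) (fun i => ?_) i
    · rw [Fin.append_left, co_pi]
      beta_reduce
      rw [Fin.append_left]
      fin_cases i <;> rfl
    · rw [Fin.append_right, co_pi]
      beta_reduce
      rw [Fin.append_right]
      rfl
  · exact fun r s hr hs => (hD.isCBD r s hr hs).isClosed
  · intro r s hr hs
    obtain ⟨u, v, huv⟩ := (hD.isCBD r s hr hs).bounded
    obtain ⟨M, -, hM⟩ := exists_mem_cube (R := R) u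
    obtain ⟨N, -, hN⟩ := exists_mem_cube (R := R) v
    refine ⟨max M N, fun x hx i => abs_le.2 ⟨?_, ?_⟩⟩
    · have h1 := (abs_le.1 (hM i)).1
      exact (neg_le_neg (le_max_left _ _)).trans (h1.trans ((huv hx).1 i))
    · have h1 := (abs_le.1 (hN i)).2
      exact ((huv hx).2 i).trans (h1.trans (le_max_right _ _))

/-! ### Closed discrete sets and local uniform finiteness -/

/-- Closed discrete subsets of `R`. -/
def Loc (A : Set R) : Prop := ∀ a, ∃ ε, 0 < ε ∧ ∀ y ∈ A, |y - a| < ε → y = a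

theorem Loc.mono {A B : Set R} (hB : Loc B) (h : A ⊆ B) : Loc A := fun a => by
  obtain ⟨ε, hε, h'⟩ := hB a
  exact ⟨ε, hε, fun y hy => h' y (h hy)⟩

theorem loc_of_finite {A : Set R} (h : ∀ a, ∃ ε, 0 < ε ∧ {y ∈ A | |y - a| < ε}.Finite) :
    Loc A := fun a => by
  obtain ⟨ε, hε, hfin⟩ := h a
  have h1 : ({y ∈ A | |y - a| < ε} \ {a})ᶜ ∈ 𝓝 a :=
    (hfin.subset sdiff_subset).isClosed.isOpen_compl.mem_nhds (by simp)
  obtain ⟨δ, hδ, h2⟩ := exists_near_subset (R := R) h1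
  refine ⟨min ε δ, lt_min hε hδ, fun y hy hya => ?_⟩
  by_contra hne
  exact h2 y (near_self_iff.2 (hya.trans_le (min_le_right _ _)))
    ⟨⟨hy, hya.trans_le (min_le_left _ _)⟩, hne⟩

/-- The infimum exists by definable completeness. It is attained because points of `A` come
arbitrarily close to it, and the only one that can be close enough is itself. -/
theorem Loc.exists_isLeast {A : Set R} (hA : Loc A) (hdef : DefP L R fun x => x ∈ A)
    (hne : A.Nonempty) (hb : BddBelow A) : ∃ a, IsLeast A a := by
  obtain ⟨a, ha⟩ := exists_isGLB_of_defP hdef hne hb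
  obtain ⟨ε, hε, h⟩ := hA a
  obtain ⟨y, hy, hya⟩ := (isGLB_lt_iff ha).1 (lt_add_of_pos_right a hε)
  have : y = a := h y hy (by
    rw [abs_of_nonneg (sub_nonneg.2 (ha.1 hy))]
    rwa [sub_lt_iff_lt_add'])
  exact ⟨a, this ▸ hy, ha.1⟩

theorem Loc.exists_isGreatest {A : Set R} (hA : Loc A) (hdef : DefP L R fun x => x ∈ A)
    (hne : A.Nonempty) (hb : BddAbove A) : ∃ a, IsGreatest A a := by
  obtain ⟨a, ha⟩ := exists_isLUB_of_defP hdef hne hb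
  obtain ⟨ε, hε, h⟩ := hA a
  obtain ⟨y, hy, hya⟩ := (lt_isLUB_iff ha).1 (sub_lt_self a hε)
  have : y = a := h y hy (by
    rw [abs_sub_comm, abs_of_nonneg (sub_nonneg.2 (ha.1 hy))]
    rwa [sub_lt_comm])
  exact ⟨a, this ▸ hy, ha.1⟩

/-- Points of `A` to the right of `a` are enumerated in increasing order: after finitely many there
remain others, and these have a least element. -/
theorem Loc.exists_encard_Ioc {A : Set R} (hA : Loc A) (hdef : DefP L R fun x => x ∈ A) {a d : R}
    (hinf : (A ∩ Ioc a d).Infinite) (k : ℕ) :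
    ∃ z ∈ Ioc a d, (A ∩ Ioc a z).encard = k + 1 := by
  have step : ∀ z, a ≤ z → (A ∩ Ioc a z).Finite → ∃ z' ∈ Ioc z d, A ∩ Ioc a z' =
      insert z' (A ∩ Ioc a z) := by
    intro z haz hz
    have hsub : (A ∩ Ioc a d) \ (A ∩ Ioc a z) ⊆ A ∩ Ioc z d := by
      rintro y ⟨⟨hy, h1, h2⟩, h3⟩
      exact ⟨hy, lt_of_not_ge fun h => h3 ⟨hy, h1, h⟩, h2⟩
    have hne : (A ∩ Ioc z d).Nonempty := ((hinf.sdiff hz).mono hsub).nonempty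
    obtain ⟨z', hz', hmin⟩ := Loc.exists_isLeast (L := L) (hA.mono inter_subset_left)
      (by
        have h1 := @hdef.mem
        simp only [mem_inter_iff, mem_Ioc]
        fun_prop) hne ⟨z, fun y hy => hy.2.1.le⟩
    refine ⟨z', hz'.2, Subset.antisymm ?_ ?_⟩
    · rintro y ⟨hy, hay, hyz⟩
      rcases le_or_gt y z with h | h
      · exact Or.inr ⟨hy, hay, h⟩
      · exact Or.inl (le_antisymm hyz (hmin ⟨hy, h, hyz.trans hz'.2.2⟩))
    · rintro y (rfl | ⟨hy, hay, hyz⟩)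
      · exact ⟨hz'.1, haz.trans_lt hz'.2.1, le_rfl⟩
      · exact ⟨hy, hay, hyz.trans hz'.2.1.le⟩
  induction k with
  | zero =>
    obtain ⟨z, hz, h⟩ := step a le_rfl (by simp)
    exact ⟨z, hz, by rw [h]; simp⟩
  | succ k ih =>
    obtain ⟨z, hz, h⟩ := ih
    obtain ⟨z', hz', h'⟩ := step z hz.1.le (finite_of_encard_eq_coe (k := k + 1) (by simpa using h))
    refine ⟨z', ⟨hz.1.trans hz'.1, hz'.2⟩, ?_⟩
    rw [h', encard_insert_of_notMem (fun hmem => hz'.1.not_ge hmem.2.2), h]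
    simp

theorem Loc.exists_encard_Ico {A : Set R} (hA : Loc A) (hdef : DefP L R fun x => x ∈ A) {a c : R}
    (hinf : (A ∩ Ico c a).Infinite) (k : ℕ) :
    ∃ z ∈ Ico c a, (A ∩ Ico z a).encard = k + 1 := by
  have step : ∀ z, z ≤ a → (A ∩ Ico z a).Finite → ∃ z' ∈ Ico c z, A ∩ Ico z' a =
      insert z' (A ∩ Ico z a) := by
    intro z haz hz
    have hsub : (A ∩ Ico c a) \ (A ∩ Ico z a) ⊆ A ∩ Ico c z := by
      rintro y ⟨⟨hy, h1, h2⟩, h3⟩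
      exact ⟨hy, h1, lt_of_not_ge fun h => h3 ⟨hy, h, h2⟩⟩
    have hne : (A ∩ Ico c z).Nonempty := ((hinf.sdiff hz).mono hsub).nonempty
    obtain ⟨z', hz', hmax⟩ := Loc.exists_isGreatest (L := L) (hA.mono inter_subset_left)
      (by
        have h1 := @hdef.mem
        simp only [mem_inter_iff, mem_Ico]
        fun_prop) hne ⟨z, fun y hy => hy.2.2.le⟩
    refine ⟨z', hz'.2, Subset.antisymm ?_ ?_⟩
    · rintro y ⟨hy, hyz, hay⟩
      rcases le_or_gt z y with h | h
      · exact Or.inr ⟨hy, h, hay⟩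
      · exact Or.inl (le_antisymm (hmax ⟨hy, hz'.2.1.trans hyz, h⟩) hyz)
    · rintro y (rfl | ⟨hy, hyz, hay⟩)
      · exact ⟨hz'.1, le_rfl, hz'.2.2.trans_le haz⟩
      · exact ⟨hy, hz'.2.2.le.trans hyz, hay⟩
  induction k with
  | zero =>
    obtain ⟨z, hz, h⟩ := step a le_rfl (by simp)
    exact ⟨z, hz, by rw [h]; simp⟩
  | succ k ih =>
    obtain ⟨z, hz, h⟩ := ih
    obtain ⟨z', hz', h'⟩ := step z hz.2.le (finite_of_encard_eq_coe (k := k + 1) (by simpa using h))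
    refine ⟨z', ⟨hz'.1, hz'.2.trans hz.2⟩, ?_⟩
    rw [h', encard_insert_of_notMem (fun hmem => hz'.2.not_ge hmem.2.1), h]
    simp

/-- Refutes the dichotomy of local uniform finiteness. The possible extra point `a` is allowed
because an admissible interval always contains its centre. -/
theorem not_infinite_or_encard_le {A B : Set R} {a : R} {N : ℕ} (h : B.encard = N + 1)
    (hBA : B ⊆ A) (hAB : A ⊆ insert a B) : ¬ (A.Infinite ∨ A.encard ≤ N) := by
  rintro (hinf | hle)
  · exact hinf (((finite_of_encard_eq_coe (k := N + 1) (by simpa using h)).insert a).subset hAB)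
  · have := (encard_le_encard hBA).trans hle
    rw [h] at this
    exact absurd this (by exact_mod_cast Nat.not_succ_le_self N)

/-- Uniform local bound for the closed discrete fibers of a definable family. -/
theorem exists_encard_le {X : S → Set R} (hX : DefFam L R X) (b : S) (a : R) :
    ∃ N : ℕ, ∃ ε : R, 0 < ε ∧ ∀ x, near x b ε → Loc (X x) →
      (X x ∩ Icc (a - ε) (a + ε)).encard ≤ N := by
  -- The parameter space is rewritten as a power indexed by `Fin m`, the form required by `LUF₂`.
  obtain ⟨m, ⟨φ⟩⟩ := Finite.exists_equiv_fin (Coord.ι R S)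
  have hdef : Def L {z : Fin (m + 1) → R | z (Fin.last m) ∈
      X ((Coord.e (R := R) (T := S)).symm fun i => z (Fin.castSucc (φ i)))} := by
    refine DefP.comp_reidx (S := Fin (m + 1) → R) hX
      (f := fun z => ((Coord.e (R := R) (T := S)).symm fun i => z (Fin.castSucc (φ i)),
        z (Fin.last m))) ?_
    refine Reidx.prodMk ⟨fun i => Fin.castSucc (φ i), fun z i => ?_⟩ (Reidx.eval _)
    rw [co_symm, co_pi]
  obtain ⟨N, -, c, d, ha, u, v, hb, hN⟩ := Tame.luf (L := L) (R := R) m _ hdef a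
    (fun j => co b (φ.symm j))
  rw [interior_Icc] at ha
  have hopen : IsOpen {x : S | ∀ j, u j < co (R := R) x (φ.symm j) ∧
      co (R := R) x (φ.symm j) < v j} := by
    simp only [ofPred_forall]
    exact isOpen_iInter_of_finite fun j =>
      (isOpen_lt continuous_const (continuous_co _)).inter
        (isOpen_lt (continuous_co _) continuous_const)
  obtain ⟨ε₁, hε₁, h₁⟩ := exists_near_subset (R := R) (hopen.mem_nhds hb)
  obtain ⟨h, hh, hh1⟩ : ∃ h, 0 < h ∧ h < min (a - c) (d - a) :=
    exists_between (lt_min (sub_pos.2 ha.1) (sub_pos.2 ha.2))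
  set ε := min ε₁ h with hε
  have hεpos : 0 < ε := lt_min hε₁ hh
  have hc : c ≤ a - ε := by
    rw [le_sub_comm]
    exact (min_le_right _ _).trans (hh1.le.trans (min_le_left _ _))
  have hd : a + ε ≤ d := by
    rw [← le_sub_iff_add_le']
    exact (min_le_right _ _).trans (hh1.le.trans (min_le_right _ _))
  refine ⟨N, ε, hεpos, fun x hx hloc => ?_⟩
  have hXx : DefP L R fun y => y ∈ X x := by
    have h1 := @hX.mem
    fun_prop
  have hx' : ∀ c' d', c' < a → a < d' → a - ε ≤ c' → d' ≤ a + ε →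
      ((X x ∩ Icc c' d').Infinite ∨ (X x ∩ Icc c' d').encard ≤ N) := by
    intro c' d' hc' hd' hcc' hdd'
    have := hN (fun j => co x (φ.symm j)) (h₁ x (hx.mono (min_le_left _ _))) c' d'
      (by rw [interior_Icc]; exact ⟨hc', hd'⟩)
      (interior_subset.trans (Icc_subset_Icc (hc.trans hcc') (hdd'.trans hd)))
    convert this using 4 <;>
    · ext y
      have : x = (Coord.e (R := R) (T := S)).symm fun i => co (R := R) x i :=
        ((Coord.e (R := R) (T := S)).symm_apply_apply x).symm
      simp only [mem_ofPred_eq, Fin.snoc_last, Fin.snoc_castSucc, Equiv.symm_apply_apply, ← this]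
  -- If the set were infinite, it would be infinite on one side of `a`. Cutting that side off at its
  -- `N + 1`-st point from `a`, and the other side within the isolation radius of `a`, leaves `N +
  -- 1` or `N + 2` points: finitely many, but more than `N`.
  refine (hx' (a - ε) (a + ε) (sub_lt_self a hεpos) (lt_add_of_pos_right a hεpos) le_rfl
    le_rfl).resolve_left fun hinf => ?_
  obtain ⟨δ, hδ, hδa⟩ := hloc a
  obtain ⟨η, hη, hη1⟩ := exists_between (lt_min hεpos hδ)
  have hηε : η ≤ ε := hη1.le.trans (min_le_left _ _)
  have hηδ : η < δ := hη1.trans_le (min_le_right _ _)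
  have hsplit : X x ∩ Icc (a - ε) (a + ε) ⊆
      (X x ∩ Ico (a - ε) a) ∪ ({a} ∪ X x ∩ Ioc a (a + ε)) := by
    rintro y ⟨hy, h1, h2⟩
    rcases lt_trichotomy y a with h | h | h
    · exact Or.inl ⟨hy, h1, h⟩
    · exact Or.inr (Or.inl h)
    · exact Or.inr (Or.inr ⟨hy, h, h2⟩)
  have hinf' := hinf.mono hsplit
  rw [infinite_union, infinite_union] at hinf'
  rcases hinf' with hinf' | hinf' | hinf'
  · obtain ⟨z, hz, hcard⟩ := hloc.exists_encard_Ico hXx hinf' N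
    refine not_infinite_or_encard_le (a := a) hcard ?_ ?_
      (hx' z (a + η) hz.2 (lt_add_of_pos_right a hη) hz.1 (by gcongr))
    · exact inter_subset_inter_right _ fun y hy =>
        ⟨hy.1, hy.2.le.trans (lt_add_of_pos_right a hη).le⟩
    · rintro y ⟨hy, hy1, hy2⟩
      rcases lt_or_ge y a with h | h
      · exact Or.inr ⟨hy, hy1, h⟩
      · refine Or.inl (hδa y hy ?_)
        rw [abs_of_nonneg (sub_nonneg.2 h)]
        exact (sub_le_iff_le_add'.2 hy2).trans_lt hηδ
  · exact hinf' (finite_singleton a)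
  · obtain ⟨z, hz, hcard⟩ := hloc.exists_encard_Ioc hXx hinf' N
    refine not_infinite_or_encard_le (a := a) hcard ?_ ?_
      (hx' (a - η) z (sub_lt_self a hη) hz.1 (by gcongr) hz.2)
    · exact inter_subset_inter_right _ fun y hy =>
        ⟨(sub_lt_self a hη).le.trans hy.1.le, hy.2⟩
    · rintro y ⟨hy, hy1, hy2⟩
      rcases lt_or_ge a y with h | h
      · exact Or.inr ⟨hy, h, hy2⟩
      · refine Or.inl (hδa y hy ?_)
        rw [abs_sub_comm, abs_of_nonneg (sub_nonneg.2 h)]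
        exact (sub_le_comm.1 hy1).trans_lt hηδ

/-- The union of a definable family of closed discrete sets that increases as the parameter tends to
`0` is locally finite. -/
theorem exists_finite_inter_Icc {G : R → Set R} (hG : DefFam L R G) (hloc : ∀ s, 0 < s → Loc (G s))
    (hanti : ∀ s s', 0 < s → s ≤ s' → G s' ⊆ G s) (a : R) :
    ∃ ε, 0 < ε ∧ ({y | ∃ s, 0 < s ∧ y ∈ G s} ∩ Icc (a - ε) (a + ε)).Finite := by
  -- The uniform bound is taken at parameter `0`, the limit of the family. Any `N + 1` points of the
  -- union lie in a common `G s` with `s` below `ε`, which exceeds the bound.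
  obtain ⟨N, ε, hε, h⟩ := exists_encard_le hG (0 : R) a
  refine ⟨ε, hε, finite_of_encard_le_coe (k := N) ?_⟩
  by_contra! hlt
  obtain ⟨t, ht, htN⟩ := exists_subset_encard_eq (k := (N + 1 : ℕ))
    (by simpa using Order.add_one_le_of_lt hlt)
  have htfin : t.Finite := finite_of_encard_eq_coe htN
  have hev : ∀ᶠ s in 𝓝[>] (0 : R), (0 < s ∧ s < ε) ∧ ∀ y ∈ t, y ∈ G s := by
    refine (Filter.Eventually.and self_mem_nhdsWithin
      (nhdsWithin_le_nhds (Iio_mem_nhds hε))).and ?_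
    rw [htfin.eventually_all]
    intro y hy
    obtain ⟨⟨s, hs, hys⟩, -⟩ := ht hy
    filter_upwards [Ioo_mem_nhdsGT hs] with s' hs'
    exact hanti s' s hs'.1 hs'.2.le hys
  obtain ⟨s, ⟨hs, hsε⟩, hst⟩ := hev.exists
  have h1 := h s (near_self_iff.2 (by rwa [sub_zero, abs_of_pos hs])) (hloc s hs)
  have h2 : t ⊆ G s ∩ Icc (a - ε) (a + ε) := fun y hy => ⟨hst y hy, (ht hy).2⟩
  have h3 := (encard_le_encard h2).trans h1
  rw [htN] at h3
  exact absurd h3 (by exact_mod_cast Nat.not_succ_le_self N)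

theorem loc_iUnion {G : R → Set R} (hG : DefFam L R G) (hloc : ∀ s, 0 < s → Loc (G s))
    (hanti : ∀ s s', 0 < s → s ≤ s' → G s' ⊆ G s) : Loc {y | ∃ s, 0 < s ∧ y ∈ G s} := by
  refine loc_of_finite fun a => ?_
  obtain ⟨ε, hε, h⟩ := exists_finite_inter_Icc hG hloc hanti a
  refine ⟨ε, hε, h.subset ?_⟩
  rintro y ⟨hy, hya⟩
  rw [abs_sub_lt_iff] at hya
  exact ⟨hy, (sub_lt_comm.1 hya.2).le, (sub_lt_iff_lt_add'.1 hya.1).le⟩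

theorem loc_of_separated {A : Set R} {t : R} (ht : 0 < t)
    (h : ∀ y ∈ A, ∀ z ∈ A, y < z → y + t ≤ z) : Loc A := by
  obtain ⟨δ, hδ, hδt⟩ := exists_add_self_le ht
  refine loc_of_finite fun a => ⟨δ, hδ, Subsingleton.finite ?_⟩
  have main : ∀ y ∈ {y ∈ A | |y - a| < δ}, ∀ z ∈ {y ∈ A | |y - a| < δ}, ¬ y < z := by
    rintro y ⟨hy, hya⟩ z ⟨hz, hza⟩ hyz
    have h1 : z - y < δ + δ := by
      calc z - y = (z - a) + (a - y) := by abel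
        _ < δ + δ := add_lt_add (abs_sub_lt_iff.1 hza).1 (abs_sub_lt_iff.1 hya).2
    have h2 := le_sub_iff_add_le'.2 (h y hy z hz hyz)
    exact (h2.trans_lt h1).not_ge hδt
  intro y hy z hz
  exact le_antisymm (not_lt.1 (main z hz y hy)) (not_lt.1 (main y hy z hz))

/-! ### The Baire property on the line -/

/-- A closed definable subset of `R` without interior is discrete. -/
theorem loc_of_interior_eq_empty {K : Set R} (hK : IsClosed K) (hdef : DefP L R fun x => x ∈ K)
    (hInt : interior K = ∅) : Loc K := by
  -- `G t` consists of the points of `K` followed by a gap of length `t`. Such points are at least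
  -- `t` apart, so the union over `t` is closed and discrete.
  set G : R → Set R := fun t => {y | y ∈ K ∧ ∀ z, y < z → z < y + t → z ∉ K} with hG
  have hloc : Loc {y | ∃ t, 0 < t ∧ y ∈ G t} := by
    refine loc_iUnion (L := L) ?_ ?_ ?_
    · have h1 := @hdef.mem
      simp only [DefFam, hG, mem_ofPred_eq]
      fun_prop
    · refine fun t ht => loc_of_separated ht fun y hy z hz hyz => ?_
      by_contra! hcon
      exact hy.2 z hyz hcon hz.1
    · rintro s s' hs hss' y ⟨hy, h⟩
      exact ⟨hy, fun z hyz hzs => h z hyz (hzs.trans_le (by gcongr))⟩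
  have hgap : ∀ p ∈ K, ∀ q, p < q → ∃ y, p ≤ y ∧ y < q ∧ ∃ t, 0 < t ∧ y ∈ G t := by
    intro p hp q hpq
    obtain ⟨z, ⟨hpz, hzq⟩, hzK⟩ : ∃ z ∈ Ioo p q, z ∉ K := by
      by_contra! hcon
      obtain ⟨m, hm⟩ := exists_between hpq
      have : m ∈ interior K := mem_interior.2 ⟨Ioo p q, hcon, isOpen_Ioo, hm⟩
      rw [hInt] at this
      exact this
    obtain ⟨y, hy⟩ := exists_isLUB_of_defP (L := L) (A := K ∩ Icc p z)
      (by
        have h1 := @hdef.mem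
        simp only [mem_inter_iff, mem_Icc]
        fun_prop) ⟨p, hp, le_rfl, hpz.le⟩ ⟨z, fun x hx => hx.2.2⟩
    have hyK : y ∈ K ∩ Icc p z :=
      hy.mem_of_isClosed ⟨p, hp, le_rfl, hpz.le⟩ (hK.inter isClosed_Icc)
    have hyz : y < z := lt_of_le_of_ne hyK.2.2 fun h => hzK (h ▸ hyK.1)
    refine ⟨y, hyK.2.1, hyz.trans hzq, z - y, sub_pos.2 hyz, hyK.1, fun x hyx hxz hxK => ?_⟩
    rw [add_sub_cancel] at hxz
    exact hyx.not_ge (hy.1 ⟨hxK, hyK.2.1.trans hyx.le, hxz.le⟩)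
  refine loc_of_finite fun a => ?_
  obtain ⟨δ, hδ, h⟩ := hloc a
  refine ⟨δ, hδ, ?_⟩
  -- From a point `p` of `K` up to any larger `q` there is a left endpoint of a gap, and near `a`
  -- only `a` itself can be one. Hence `K` has at most one point on each side of `a` nearby.
  have key : ∀ p ∈ K, |p - a| < δ → ∀ q, |q - a| < δ → p < q → p ≤ a ∧ a < q := by
    intro p hp hpa q hqa hpq
    obtain ⟨y, hpy, hyq, hy⟩ := hgap p hp q hpq
    have : y = a := h y hy (abs_sub_lt_iff.2
      ⟨(sub_le_sub_right hyq.le a).trans_lt (abs_sub_lt_iff.1 hqa).1,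
        (sub_le_sub_left hpy a).trans_lt (abs_sub_lt_iff.1 hpa).2⟩)
    exact ⟨this ▸ hpy, this ▸ hyq⟩
  have hsub : {y ∈ K | |y - a| < δ} ⊆
      {y ∈ K | |y - a| < δ ∧ y < a} ∪ ({a} ∪ {y ∈ K | |y - a| < δ ∧ a < y}) := by
    rintro y ⟨hy, hya⟩
    rcases lt_trichotomy y a with h | h | h
    · exact Or.inl ⟨hy, hya, h⟩
    · exact Or.inr (Or.inl h)
    · exact Or.inr (Or.inr ⟨hy, hya, h⟩)
  refine Finite.subset (Finite.union (Subsingleton.finite ?_)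
    ((finite_singleton a).union (Subsingleton.finite ?_))) hsub
  · rintro y ⟨hy, hya, hy'⟩ z ⟨hz, hza, hz'⟩
    refine le_antisymm (not_lt.1 fun hlt => ?_) (not_lt.1 fun hlt => ?_)
    · exact hy'.not_gt (key z hz hza y hya hlt).2
    · exact hz'.not_gt (key y hy hya z hza hlt).2
  · rintro y ⟨hy, hya, hy'⟩ z ⟨hz, hza, hz'⟩
    refine le_antisymm (not_lt.1 fun hlt => ?_) (not_lt.1 fun hlt => ?_)
    · exact hz'.not_ge (key z hz hza y hya hlt).1
    · exact hy'.not_ge (key y hy hya z hza hlt).1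

/-- If the union were dense in an interval, each scale `s` would determine a value of `r` at which
`E r` is already `s`-dense. Choosing closed discrete sets accordingly gives a family, monotone in
`s`, whose union is dense, whereas such unions are locally finite. -/
theorem interior_closure_uni_eq_empty_of_line {F : R → R → Set R} (hF : DFam L F)
    (hInt : ∀ r s, 0 < r → 0 < s → interior (F r s) = ∅) :
    interior (closure (uni F)) = ∅ := by
  have hFm := @hF.defn.mem₂
  set E : R → Set R := fun r => {y | ∃ s, 0 < s ∧ y ∈ F r s} with hE
  have hEdef : DefFam L R E := by
    simp only [DefFam, hE, mem_ofPred_eq]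
    fun_prop
  have hEm := @hEdef.mem
  have hEloc : ∀ r, 0 < r → Loc (E r) := by
    intro r hr
    refine loc_iUnion (L := L) ?_ ?_ ?_
    · simp only [DefFam]
      fun_prop
    · exact fun s hs => loc_of_interior_eq_empty (hF.isClosed r s hr hs) (hF.isCB hr hs).defn
        (hInt r s hr hs)
    · exact fun s s' hs hss' => hF.anti r s s' hr hs hss'
  have hEmono : ∀ r r', 0 < r → r ≤ r' → E r ⊆ E r' := by
    rintro r r' hr hrr' y ⟨s, hs, hy⟩
    exact ⟨s, hs, hF.mono r r' s hr hs hrr' hy⟩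
  by_contra hne
  obtain ⟨x₀, hx₀⟩ := nonempty_iff_ne_empty.2 hne
  obtain ⟨δ, hδ, hcl⟩ := (mem_interior_iff_near (R := R)).1 hx₀
  simp only [near_self_iff] at hcl
  -- `A s` holds the `r` for which `E r` meets every open subinterval of length `s`.
  set A : R → Set R := fun s => {r | 0 < r ∧ ∀ y, x₀ - δ ≤ y → y + s ≤ x₀ + δ →
    ∃ z, z ∈ E r ∧ y < z ∧ z < y + s} with hA
  have hAdef : DefFam L R A := by
    simp only [DefFam, hA, mem_ofPred_eq]
    fun_prop
  have hAm := @hAdef.mem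
  have hAne : ∀ s, 0 < s → (A s).Nonempty := by
    intro s hs
    by_contra hAemp
    have hAr : ∀ r, 0 < r → r ∉ A s := fun r _ h => hAemp ⟨r, h⟩
    -- If no `r` works, the left ends of intervals of length `s` missed by `E r` form a chain. A
    -- common adherent `y` would give an interval missed by all the sets `E r`, hence by a dense
    -- set.
    obtain ⟨y, hy⟩ := exists_mem_closure_of_chain (S := R) (L := L) (I := Ioi 0)
      (F := fun r => {y | (x₀ - δ ≤ y ∧ y + s ≤ x₀ + δ) ∧ ∀ z, z ∈ E r → ¬ (y < z ∧ z < y + s)})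
      (M := max |x₀ - δ| |x₀ + δ|)
      (by simp only [mem_Ioi]; fun_prop) nonempty_Ioi
      (by
        simp only [DefFam, mem_ofPred_eq]
        fun_prop)
      (by
        intro r hr
        have := hAr r hr
        simp only [hA, mem_ofPred_eq, not_and, not_forall] at this
        obtain ⟨y, h1, h2, h3⟩ := this hr
        exact ⟨y, ⟨h1, h2⟩, fun z hz h => h3 ⟨z, hz, h⟩⟩)
      (by
        intro r hr r' hr'
        rcases le_total r r' with h | h
        · exact Or.inr fun y hy => ⟨hy.1, fun z hz => hy.2 z (hEmono r r' hr h hz)⟩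
        · exact Or.inl fun y hy => ⟨hy.1, fun z hz => hy.2 z (hEmono r' r hr' h hz)⟩)
      (by
        rintro r hr y ⟨⟨h1, h2⟩, -⟩
        exact abs_le_max_abs_abs h1 ((le_add_of_nonneg_right hs.le).trans h2))
    have hybd : x₀ - δ ≤ y ∧ y + s ≤ x₀ + δ := by
      have hc : IsClosed {y | x₀ - δ ≤ y ∧ y + s ≤ x₀ + δ} :=
        (isClosed_le continuous_const continuous_id).inter
          (isClosed_le (continuous_id.add continuous_const) continuous_const)
      exact closure_minimal (fun y hy => hy.1) hc (hy δ hδ)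
    obtain ⟨w, hyw, hws⟩ := exists_between (lt_add_of_pos_right y hs)
    have hwcl : w ∈ closure (uni F) := hcl w (abs_sub_lt_iff.2
      ⟨sub_lt_iff_lt_add'.2 (hws.trans_le hybd.2), sub_lt_comm.1 (hybd.1.trans_lt hyw)⟩)
    obtain ⟨z, hz, r, s', hr, hs', hzF⟩ :=
      mem_closure_iff.1 hwcl (Ioo y (y + s)) isOpen_Ioo ⟨hyw, hws⟩
    obtain ⟨y', hy', hy'r⟩ := (mem_closure_iff_near (R := R)).1 (hy r hr)
      (min (z - y) (y + s - z)) (lt_min (sub_pos.2 hz.1) (sub_pos.2 hz.2))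
    have h1 := abs_sub_lt_iff.1 (near_self_iff.1 hy')
    refine hy'r.2 z ⟨s', hs', hzF⟩ ⟨?_, ?_⟩
    · have := h1.1.trans_le (min_le_left _ _)
      rwa [sub_lt_sub_iff_right] at this
    · have h2 := h1.2.trans_le (min_le_right _ _)
      have h3 : z < y + s - (y - y') := lt_sub_comm.1 h2
      have h4 : y + s - (y - y') = y' + s := by abel
      rwa [h4] at h3
  obtain ⟨e, he⟩ := exists_gt (0 : R)
  -- A definable substitute for choosing some `E r` with `r` in `A s`. The shift by `e` is needed
  -- since the infimum of `A s` may not be attained: an `r` of `A s` within `e` of it satisfies `E r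
  -- ⊆ Z s`.
  set Z : R → Set R := fun s => {y | ∀ r, r ∈ A s → y ∈ E (r + e)} with hZ
  have hAanti : ∀ s s', 0 < s → s ≤ s' → A s ⊆ A s' := by
    rintro s s' hs hss' r ⟨hr, h⟩
    refine ⟨hr, fun y hy hy' => ?_⟩
    obtain ⟨z, hz, hyz, hzs⟩ := h y hy (le_trans (by gcongr) hy')
    exact ⟨z, hz, hyz, hzs.trans_le (by gcongr)⟩
  obtain ⟨ε, hε, hfin⟩ := exists_finite_inter_Icc (L := L) (G := Z)
    (by
      simp only [DefFam, hZ, mem_ofPred_eq]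
      fun_prop)
    (by
      intro s hs
      obtain ⟨r, hr⟩ := hAne s hs
      exact (hEloc (r + e) (add_pos hr.1 he)).mono fun y hy => hy r hr)
    (fun s s' hs hss' y hy r hr => hy r (hAanti s s' hs hss' hr)) x₀
  have hdense : ∀ s, 0 < s → ∀ y, x₀ - δ ≤ y → y + s ≤ x₀ + δ → ∃ z ∈ Z s, y < z ∧ z < y + s := by
    intro s hs y hy hys
    obtain ⟨ρ, hρ⟩ := exists_isGLB_of_defP (L := L) (A := A s) (by fun_prop) (hAne s hs)
      ⟨0, fun r hr => hr.1.le⟩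
    obtain ⟨r, hr, hrρ⟩ := (isGLB_lt_iff hρ).1 (lt_add_of_pos_right ρ he)
    obtain ⟨z, hz, hyz⟩ := hr.2 y hy hys
    exact ⟨z, fun r' hr' => hEmono r (r' + e) hr.1
      (hrρ.le.trans (add_le_add_left (hρ.1 hr') e)) hz, hyz⟩
  have hη : 0 < min δ ε := lt_min hδ hε
  obtain ⟨w, hw, hwQ⟩ := (Ioo_infinite ((sub_lt_self x₀ hη).trans
    (lt_add_of_pos_right x₀ hη))).exists_notMem_finite hfin
  have hU : Ioo (x₀ - min δ ε) (x₀ + min δ ε) ∩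
      ({y | ∃ s, 0 < s ∧ y ∈ Z s} ∩ Icc (x₀ - ε) (x₀ + ε))ᶜ ∈ 𝓝 w :=
    (isOpen_Ioo.inter hfin.isClosed.isOpen_compl).mem_nhds ⟨hw, hwQ⟩
  obtain ⟨s', hs', hsub⟩ := exists_near_subset (R := R) hU
  obtain ⟨s, hs, hss'⟩ := exists_between hs'
  have hmem : ∀ z, w ≤ z → z ≤ w + s → z ∈ Ioo (x₀ - min δ ε) (x₀ + min δ ε) ∩
      ({y | ∃ s, 0 < s ∧ y ∈ Z s} ∩ Icc (x₀ - ε) (x₀ + ε))ᶜ := by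
    intro z hz hz'
    refine hsub z (near_self_iff.2 ?_)
    rw [abs_of_nonneg (sub_nonneg.2 hz)]
    exact (sub_le_iff_le_add'.2 hz').trans_lt hss'
  have hws := (hmem (w + s) (le_add_of_nonneg_right hs.le) le_rfl).1.2
  obtain ⟨z, hz, hwz, hzs⟩ := hdense s hs w
    ((sub_le_sub_left (min_le_left _ _) _).trans hw.1.le)
    (hws.le.trans (by gcongr; exact min_le_left _ _))
  have hz' := hmem z hwz.le hzs.le
  exact hz'.2 ⟨⟨s, hs, hz⟩, (sub_le_sub_left (min_le_right _ _) _).trans hz'.1.1.le,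
    hz'.1.2.le.trans (by gcongr; exact min_le_right _ _)⟩

theorem loc_uni {F : R → R → Set R} (hF : DFam L F)
    (hInt : ∀ r s, 0 < r → 0 < s → interior (F r s) = ∅) : Loc (uni F) := by
  exact (loc_of_interior_eq_empty (L := L) isClosed_closure hF.defP_uni.closure
    (interior_closure_uni_eq_empty_of_line hF hInt)).mono subset_closure

/-! ### The Baire property in higher dimension -/

variable (L R) in
/-- In `T`, a union of a family as in `DFam` is nowhere dense as soon as all members of the family
have empty interior. -/
def IsBaire (T : Type w) [TopologicalSpace T] [Coord R T] : Prop :=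
  ∀ F : R → R → Set T, DFam L F → (∀ r s, 0 < r → 0 < s → interior (F r s) = ∅) →
    interior (closure (uni F)) = ∅

/-- The closed box of radius `h` about `w`. -/
def cball (w : T) (h : R) : Set T := {x | ∀ i : Coord.ι R T, |co x i - co w i| ≤ h}

theorem isClosed_cball (w : T) (h : R) : IsClosed (cball w h) := by
  have : cball w h = ⋂ i : Coord.ι R T, {y : T | |co y i - co w i| ≤ h} := by
    ext y
    simp [cball]
  rw [this]
  exact isClosed_iInter fun i =>
    isClosed_le (((continuous_co i).sub continuous_const).abs) continuous_const

theorem defP_cball (w : T) (h : R) : DefP L R fun x => x ∈ cball w h := by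
  simp only [cball, mem_ofPred_eq]
  fun_prop

theorem mem_cball_of_near {x w : T} {h : R} (hx : near x w h) : x ∈ cball w h :=
  fun i => (hx i).le

theorem exists_cball_subset {w : T} {U : Set T} (hU : U ∈ 𝓝 w) :
    ∃ h : R, 0 < h ∧ cball w h ⊆ U := by
  obtain ⟨ε, hε, h⟩ := exists_near_subset (R := R) hU
  obtain ⟨δ, hδ, hδε⟩ := exists_between hε
  exact ⟨δ, hδ, fun x hx => h x fun i => (hx i).trans_lt hδε⟩

/-- Local form of the property: intersecting the family with a closed box inside `W` removes any
interior lying outside `W` and keeps density in the open box. -/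
theorem IsBaire.exists_inter_interior (hT : IsBaire L R T) {F : R → R → Set T} (hF : DFam L F)
    {W : Set T} (hW : IsOpen W) (hne : W.Nonempty) (hsub : W ⊆ closure (uni F)) :
    ∃ r s, 0 < r ∧ 0 < s ∧ (W ∩ interior (F r s)).Nonempty := by
  by_contra! hcon
  obtain ⟨w, hw⟩ := hne
  obtain ⟨h, hh, hhW⟩ := exists_cball_subset (R := R) (hW.mem_nhds hw)
  have hG := DFam.of_isClosed (isClosed_cball w h) (defP_cball (L := L) w h)
  have hemp := hT _ (hF.inter hG) (by
    intro r s hr hs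
    rw [eq_empty_iff_forall_notMem]
    intro x hx
    have h1 : x ∈ W := hhW (interior_subset hx).2.1
    have h2 : x ∈ interior (F r s) := interior_mono inter_subset_left hx
    exact (hcon r s hr hs).subset ⟨h1, h2⟩)
  rw [hF.uni_inter hG, uni_inter_cube] at hemp
  refine hemp.subset (mem_interior.2 ⟨{x | near x w h}, fun x hx => ?_, isOpen_near w h,
    near_self w hh⟩)
  rw [mem_closure_iff]
  intro O hO hxO
  obtain ⟨y, ⟨hyO, hy⟩, hyF⟩ := mem_closure_iff.1 (hsub (hhW (mem_cball_of_near hx)))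
    (O ∩ {x | near x w h}) (hO.inter (isOpen_near w h)) ⟨hxO, hx⟩
  exact ⟨y, hyO, hyF, mem_cball_of_near hy⟩

/-- If `V` projects onto an open set, it does so near a suitable point of `T × R`. -/
theorem IsBaire.exists_concentrated (hT : IsBaire L R T) {V : Set (T × R)} (hV : DSig L R V)
    {W : Set T} (hW : IsOpen W) (hne : W.Nonempty) (hsub : W ⊆ Prod.fst '' V) :
    ∃ b ∈ W, ∃ c : R, ∀ ε δ : R, 0 < ε → 0 < δ → ∃ W' : Set T, IsOpen W' ∧ W'.Nonempty ∧
      W' ⊆ W ∧ (∀ w ∈ W', near w b δ) ∧ ∀ w ∈ W', ∃ y, (w, y) ∈ V ∧ |y - c| < ε := by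
  obtain ⟨F, hF, rfl⟩ := hV
  obtain ⟨r, s, hr, hs, w₀, hw₀, hw₀'⟩ := hT.exists_inter_interior (hF.image Reidx.fst) hW hne
    (by rw [DFam.uni_image]; exact hsub.trans subset_closure)
  obtain ⟨h, hh, hhW⟩ := exists_cball_subset (R := R)
    (Filter.inter_mem (hW.mem_nhds hw₀) (isOpen_interior.mem_nhds hw₀'))
  set K : Set (T × R) := F r s ∩ {p | p.1 ∈ cball w₀ h} with hK
  have hKcb : IsCB L R K := by
    refine ⟨(hF.isClosed r s hr hs).inter ((isClosed_cball w₀ h).preimage continuous_fst),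
      (hF.bdd r s hr hs).inter_left, ?_⟩
    have h1 := @(hF.isCB hr hs).defn.mem
    have h2 := @(defP_cball (L := L) w₀ h).mem
    simp only [hK, mem_inter_iff, mem_ofPred_eq]
    fun_prop
  have hKm := @hKcb.defn.mem
  obtain ⟨M, hM⟩ := hKcb.bdd
  set A : R → Set T := fun c => Prod.fst '' (K ∩ {p | p.2 ≤ c}) with hA
  have hAcl : ∀ c, IsClosed (A c) := by
    intro c
    refine IsCB.isClosed_image_fst (L := L) (R := R)
      ⟨hKcb.isClosed.inter (isClosed_le continuous_snd continuous_const),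
        hKcb.bdd.inter_left, ?_⟩
    simp only [mem_inter_iff, mem_ofPred_eq]
    fun_prop
  have hAmem : ∀ c x, x ∈ A c ↔ ∃ z, (x, z) ∈ K ∧ z ≤ c := by
    intro c x
    constructor
    · rintro ⟨⟨x, z⟩, ⟨h1, h2⟩, rfl⟩
      exact ⟨z, h1, h2⟩
    · rintro ⟨z, h1, h2⟩
      exact ⟨(x, z), ⟨h1, h2⟩, rfl⟩
  have hAmono : ∀ c c', c ≤ c' → A c ⊆ A c' := by
    intro c c' hcc' x hx
    obtain ⟨z, h1, h2⟩ := (hAmem c x).1 hx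
    exact (hAmem c' x).2 ⟨z, h1, h2.trans hcc'⟩
  -- `c₀` is the threshold height at which the part of `K` below it starts to have a projection with
  -- interior.
  obtain ⟨c₀, hc₀⟩ := exists_isGLB_of_defP (L := L) (A := {c | (interior (A c)).Nonempty})
    (by
      have : DefP L R fun c : R => ∃ x : T, ∃ ε : R, 0 < ε ∧ ∀ y, near y x ε →
          ∃ z, (y, z) ∈ K ∧ z ≤ c := by fun_prop
      refine this.congr fun c => ?_
      simp only [mem_ofPred_eq, Set.Nonempty, mem_interior_iff_near (R := R), hAmem])
    (by
      refine ⟨M, w₀, mem_interior.2 ⟨{x | near x w₀ h}, fun x hx => ?_, isOpen_near w₀ h,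
        near_self w₀ hh⟩⟩
      have hx' := mem_cball_of_near hx
      obtain ⟨⟨x, z⟩, h1, rfl⟩ := interior_subset (hhW hx').2
      exact (hAmem M x).2 ⟨z, ⟨h1, hx'⟩, (abs_le.1 (hM (x, z) ⟨h1, hx'⟩ (Sum.inr ()))).2⟩)
    (by
      refine ⟨-M, ?_⟩
      rintro c ⟨x, hx⟩
      obtain ⟨z, h1, h2⟩ := (hAmem c x).1 (interior_subset hx)
      exact (abs_le.1 (hM (x, z) h1 (Sum.inr ()))).1.trans h2)
  set Q : R → Set T := fun ε => interior {x | ∃ z, (x, z) ∈ K ∧ |z - c₀| ≤ ε} with hQ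
  have hQne : ∀ ε, 0 < ε → (Q ε).Nonempty := by
    intro ε hε
    obtain ⟨c, hc, hcε⟩ := (isGLB_lt_iff hc₀).1 (lt_add_of_pos_right c₀ hε)
    have h1 : (interior (A (c₀ + ε))).Nonempty := hc.mono (interior_mono (hAmono _ _ hcε.le))
    -- Below the threshold the projection is closed without interior, so removing it from an open
    -- set leaves a nonempty open set. Over the remainder, `K` has a point at height within `ε` of
    -- `c₀`.
    have h2 : ¬ (interior (A (c₀ - ε))).Nonempty := fun h =>
      (sub_lt_self c₀ hε).not_ge (hc₀.1 h)
    have h3 : (interior (A (c₀ + ε)) \ A (c₀ - ε)).Nonempty := by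
      by_contra hemp
      rw [not_nonempty_iff_eq_empty, sdiff_eq_empty] at hemp
      exact h2 (h1.mono (interior_maximal hemp isOpen_interior))
    refine h3.mono (interior_maximal ?_ (isOpen_interior.sdiff (hAcl _)))
    rintro x ⟨hx, hx'⟩
    obtain ⟨z, hz, hzc⟩ := (hAmem _ x).1 (interior_subset hx)
    refine ⟨z, hz, abs_le.2 ⟨?_, sub_le_iff_le_add'.2 hzc⟩⟩
    rw [neg_le_sub_iff_le_add, ← sub_le_iff_le_add]
    by_contra! hcon
    exact hx' ((hAmem _ x).2 ⟨z, hz, hcon.le⟩)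
  have hQK : ∀ ε, Q ε ⊆ cball w₀ h := by
    intro ε x hx
    obtain ⟨z, hz, -⟩ := interior_subset hx
    exact hz.2
  obtain ⟨b, hb⟩ := exists_mem_closure_of_decreasing (L := L) (R := R) (F := Q) (M := M)
    (by
      have : DefP L R fun p : R × T => ∃ η : R, 0 < η ∧ ∀ y, near y p.2 η →
          ∃ z, (y, z) ∈ K ∧ |z - c₀| ≤ p.1 := by fun_prop
      refine this.congr fun p => ?_
      simp only [hQ, mem_interior_iff_near (R := R), mem_ofPred_eq])
    hQne
    (fun ε δ _ hεδ => interior_mono fun x hx => hx.imp fun z hz => ⟨hz.1, hz.2.trans hεδ⟩)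
    (by
      intro ε hε x hx i
      obtain ⟨z, hz, -⟩ := interior_subset hx
      exact hM (x, z) hz (Sum.inl i))
  obtain ⟨a, ha⟩ := exists_gt (0 : R)
  refine ⟨b, (hhW ((isClosed_cball w₀ h).closure_subset_iff.2 (hQK a) (hb a ha))).1, c₀,
    fun ε δ hε hδ => ?_⟩
  obtain ⟨ε', hε', hε'ε⟩ := exists_between hε
  refine ⟨Q ε' ∩ {w | near w b δ}, isOpen_interior.inter (isOpen_near b δ), ?_, ?_, ?_, ?_⟩
  · obtain ⟨y, hy, hyQ⟩ := (mem_closure_iff_near (R := R)).1 (hb ε' hε') δ hδ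
    exact ⟨y, hyQ, hy⟩
  · exact fun w hw => (hhW (hQK _ hw.1)).1
  · exact fun w hw => hw.2
  · intro w hw
    obtain ⟨z, hz, hzc⟩ := interior_subset hw.1
    exact ⟨z, ⟨r, s, hr, hs, hz.1⟩, hzc.trans_lt hε'ε⟩

/-- Generic fibers of a nowhere dense set are closed and discrete. -/
theorem IsBaire.exists_forall_loc (hT : IsBaire L R T) {F : R → R → Set (T × R)} (hF : DFam L F)
    (hInt : ∀ r s, 0 < r → 0 < s → interior (F r s) = ∅) {W : Set T} (hW : IsOpen W)
    (hne : W.Nonempty) :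
    ∃ W' : Set T, IsOpen W' ∧ W'.Nonempty ∧ W' ⊆ W ∧ ∀ w ∈ W', Loc {y | (w, y) ∈ uni F} := by
  -- `H r s` holds the midpoints of vertical segments of half-length `s` inside `F r s`. A fiber of
  -- `F r s` with interior puts the base point in the projection of some `H r s'`.
  set H : R → R → Set (T × R) := fun r s => {p | ∀ z, |z| ≤ s → (p.1, p.2 + z) ∈ F r s} with hHdef
  have hHF : ∀ r s, 0 < s → H r s ⊆ F r s := by
    intro r s hs p hp
    simpa using hp 0 (by simpa using hs.le)
  have hH : DFam L H := by
    refine ⟨?_, ?_, ?_, ?_, ?_⟩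
    · have h1 := @hF.defn.mem₂
      simp only [DefFam, hHdef, mem_ofPred_eq]
      fun_prop
    · intro r s hr hs
      simp only [hHdef, ofPred_forall]
      refine isClosed_iInter fun z => isClosed_iInter fun _ => ?_
      exact (hF.isClosed r s hr hs).preimage
        (continuous_fst.prodMk (continuous_snd.add continuous_const))
    · exact fun r s hr hs => (hF.bdd r s hr hs).mono (hHF r s hs)
    · exact fun r r' s hr hs hrr' p hp z hz => hF.mono r r' s hr hs hrr' (hp z hz)
    · exact fun r s s' hr hs hss' p hp z hz => hF.anti r s s' hr hs hss' (hp z (hz.trans hss'))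
  have hE := hT _ (hH.image Reidx.fst) (by
    intro r s hr hs
    by_contra hcon
    obtain ⟨b, -, c, hbc⟩ := hT.exists_concentrated
      (DSig.of_isClosed (hH.isClosed r s hr hs) (hH.isCB hr hs).defn)
      isOpen_interior (nonempty_iff_ne_empty.2 hcon) interior_subset
    -- Two heights within `h` of `c` differ by at most `s`, so the segments around height `c` all
    -- cover the same interval. This gives an open box inside `F r s`.
    obtain ⟨h, hh, hhs⟩ := exists_add_self_le hs
    obtain ⟨W', hW', ⟨w, hw⟩, -, -, hW'V⟩ := hbc h h hh hh
    have hsub : W' ×ˢ {y | |y - c| < h} ⊆ F r s := by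
      rintro ⟨w, y⟩ ⟨hw, hy⟩
      obtain ⟨y', hy', hy'c⟩ := hW'V w hw
      have h1 : |y - y'| ≤ s := by
        refine (abs_sub_le y c y').trans (le_trans ?_ hhs)
        rw [abs_sub_comm c y']
        exact add_le_add (le_of_lt hy) hy'c.le
      simpa using hy' (y - y') h1
    have hop : IsOpen (W' ×ˢ {y : R | |y - c| < h}) :=
      hW'.prod (isOpen_lt ((continuous_id.sub continuous_const).abs) continuous_const)
    refine (hInt r s hr hs).subset (interior_maximal hsub hop (show (w, c) ∈ _ from ⟨hw, ?_⟩))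
    simpa using hh)
  refine ⟨W \ closure (uni fun r s => Prod.fst '' H r s), hW.sdiff isClosed_closure, ?_,
    sdiff_subset, ?_⟩
  · by_contra hemp
    rw [not_nonempty_iff_eq_empty, sdiff_eq_empty] at hemp
    obtain ⟨w, hw⟩ := hne
    exact hE.subset (interior_maximal hemp hW hw)
  · rintro w ⟨-, hw⟩
    refine loc_uni (hF.fiber w) fun r s hr hs => ?_
    by_contra hcon
    obtain ⟨y, hy⟩ := nonempty_iff_ne_empty.2 hcon
    obtain ⟨t, ht, hyt⟩ := (mem_interior_iff_near (R := R)).1 hy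
    obtain ⟨s', hs', hs'1⟩ := exists_between (lt_min hs ht)
    have hs's : s' ≤ s := hs'1.le.trans (min_le_left _ _)
    have hs't : s' < t := hs'1.trans_le (min_le_right _ _)
    refine hw (subset_closure ⟨r, s', hr, hs', (w, y), fun z hz => ?_, rfl⟩)
    refine hF.anti r s' s hr hs' hs's (hyt (y + z) (near_self_iff.2 ?_))
    simpa using hz.trans_lt hs't

/-- Over a smaller open set all fibers are closed and discrete, hence have at most `N` points near a
suitable place. If the union were dense in a box, then over any open subset of the base and in any
subinterval, `hone` would find a still smaller open set all of whose fibers meet that subinterval.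
With disjoint subintervals, `N + 1` rounds exceed the bound. -/
theorem IsBaire.prod (hT : IsBaire L R T) : IsBaire L R (T × R) := by
  intro F hF hInt
  by_contra hcon
  obtain ⟨⟨b₀, a₀⟩, hx₀⟩ := nonempty_iff_ne_empty.2 hcon
  obtain ⟨ε₀, hε₀, hcl⟩ := (mem_interior_iff_near (R := R)).1 hx₀
  obtain ⟨W, hW, ⟨b, hb⟩, hWb₀, hWloc⟩ := hT.exists_forall_loc hF hInt (isOpen_near b₀ ε₀)
    ⟨b₀, near_self b₀ hε₀⟩
  obtain ⟨N, ε, hε, hN⟩ := exists_encard_le (L := L) (X := fun w : T => {y | (w, y) ∈ uni F})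
    hF.defP_uni b a₀
  have hone : ∀ W' : Set T, IsOpen W' → W'.Nonempty → W' ⊆ W → ∀ p q, p < q → a₀ - ε₀ ≤ p →
      q ≤ a₀ + ε₀ → ∃ W'' : Set T, IsOpen W'' ∧ W''.Nonempty ∧ W'' ⊆ W' ∧
        ∀ w ∈ W'', ∃ y ∈ Ioo p q, (w, y) ∈ uni F := by
    intro W' hW' hne hsub p q hpq hp hq
    have hO : DSig L R {z : T × R | z.2 ∈ Ioo p q} := by
      refine DSig.of_isOpen (isOpen_Ioo.preimage continuous_snd) ?_
      simp only [mem_ofPred_eq, mem_Ioo]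
      fun_prop
    obtain ⟨G, hG, hGO⟩ := DSig.image (DSig.inter ⟨F, hF, rfl⟩ hO) (Reidx.fst (R := R))
    obtain ⟨r, s, hr, hs, hne'⟩ := hT.exists_inter_interior hG hW' hne (by
      intro w hw
      rw [← hGO, mem_closure_iff]
      intro U hU hwU
      obtain ⟨m, hpm, hmq⟩ := exists_between hpq
      have hmem : (w, m) ∈ closure (uni F) := hcl (w, m) (near_prod_iff.2 ⟨hWb₀ (hsub hw),
        near_self_iff.2 (abs_sub_lt_iff.2 ⟨sub_lt_iff_lt_add'.2 (hmq.trans_le hq),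
          sub_lt_comm.1 (hp.trans_lt hpm)⟩)⟩)
      obtain ⟨⟨w', m'⟩, ⟨h1, h2⟩, h3⟩ := mem_closure_iff.1 hmem (U ×ˢ Ioo p q)
        (hU.prod isOpen_Ioo) ⟨hwU, hpm, hmq⟩
      exact ⟨w', h1, (w', m'), ⟨h3, h2⟩, rfl⟩)
    refine ⟨_, hW'.inter isOpen_interior, hne', inter_subset_left, fun w hw => ?_⟩
    have hw' : w ∈ uni G := subset_uni G hr hs (interior_subset hw.2)
    rw [← hGO] at hw'
    obtain ⟨⟨w, y⟩, ⟨h1, h2⟩, rfl⟩ := hw'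
    exact ⟨y, h2, h1⟩
  have hmany : ∀ k : ℕ, ∀ W' : Set T, IsOpen W' → W'.Nonempty → W' ⊆ W → ∀ p q, p < q →
      a₀ - ε₀ ≤ p → q ≤ a₀ + ε₀ → ∃ W'' : Set T, IsOpen W'' ∧ W''.Nonempty ∧ W'' ⊆ W' ∧
        ∀ w ∈ W'', (k : ℕ∞) ≤ ({y | (w, y) ∈ uni F} ∩ Ioo p q).encard := by
    intro k
    induction k with
    | zero => exact fun W' hW' hne _ p q _ _ _ => ⟨W', hW', hne, Subset.rfl, by simp⟩
    | succ k ih =>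
      intro W' hW' hne hsub p q hpq hp hq
      obtain ⟨m, hpm, hmq⟩ := exists_between hpq
      obtain ⟨W₁, hW₁, hne₁, hsub₁, h₁⟩ := ih W' hW' hne hsub p m hpm hp (hmq.le.trans hq)
      obtain ⟨W₂, hW₂, hne₂, hsub₂, h₂⟩ := hone W₁ hW₁ hne₁ (hsub₁.trans hsub) m q hmq
        (hp.trans hpm.le) hq
      refine ⟨W₂, hW₂, hne₂, hsub₂.trans hsub₁, fun w hw => ?_⟩
      obtain ⟨y, hy, hyF⟩ := h₂ w hw
      have hins : insert y ({y | (w, y) ∈ uni F} ∩ Ioo p m) ⊆ {y | (w, y) ∈ uni F} ∩ Ioo p q := by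
        rintro z (rfl | ⟨hz, hz'⟩)
        · exact ⟨hyF, hpm.trans hy.1, hy.2⟩
        · exact ⟨hz, hz'.1, hz'.2.trans hmq⟩
      refine le_trans ?_ (encard_le_encard hins)
      rw [encard_insert_of_notMem fun h => hy.1.not_gt h.2.2]
      push_cast
      gcongr
      exact h₁ w (hsub₂ hw)
  have hη : 0 < min ε ε₀ := lt_min hε hε₀
  obtain ⟨W₁, -, ⟨w, hw⟩, hsub₁, h₁⟩ := hmany (N + 1) (W ∩ {x | near x b ε})
    (hW.inter (isOpen_near b ε)) ⟨b, hb, near_self b hε⟩ inter_subset_left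
    (a₀ - min ε ε₀) (a₀ + min ε ε₀) ((sub_lt_self a₀ hη).trans (lt_add_of_pos_right a₀ hη))
    (sub_le_sub_left (min_le_right _ _) _) (by gcongr; exact min_le_right _ _)
  have h2 := hN w (hsub₁ hw).2 (hWloc w (hsub₁ hw).1)
  have h3 : {y | (w, y) ∈ uni F} ∩ Ioo (a₀ - min ε ε₀) (a₀ + min ε ε₀) ⊆
      {y | (w, y) ∈ uni F} ∩ Icc (a₀ - ε) (a₀ + ε) :=
    inter_subset_inter_right _ fun y hy =>
      ⟨(sub_le_sub_left (min_le_left _ _) _).trans hy.1.le,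
        hy.2.le.trans (by gcongr; exact min_le_left _ _)⟩
  have h4 := (h₁ w hw).trans ((encard_le_encard h3).trans h2)
  exact absurd h4 (by exact_mod_cast Nat.not_succ_le_self N)

theorem IsBaire.of_reidx (hS : IsBaire L R S) {f : S → T} {g : T → S} (hf : Reidx R f)
    (hg : Reidx R g) (hfg : Function.LeftInverse f g) (hgf : Function.LeftInverse g f) :
    IsBaire L R T := by
  intro F hF hInt
  let φ : T ≃ₜ S := ⟨⟨g, f, hfg, hgf⟩, hg.continuous, hf.continuous⟩
  have h := hS _ (hF.image hg) (by
    intro r s hr hs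
    have := φ.image_interior (F r s)
    rw [hInt r s hr hs, image_empty] at this
    exact this.symm)
  rw [DFam.uni_image] at h
  have h2 : φ '' interior (closure (uni F)) = ∅ := by
    rw [φ.image_interior, φ.image_closure]
    exact h
  exact image_eq_empty.1 h2

theorem isBaire_pi (k : ℕ) : IsBaire L R (Fin k → R) := by
  induction k with
  | zero =>
    intro F hF hInt
    by_contra hcon
    obtain ⟨x, hx⟩ := nonempty_iff_ne_empty.2 hcon
    obtain ⟨y, r, s, hr, hs, hy⟩ : (uni F).Nonempty :=
      closure_nonempty_iff.1 ⟨x, interior_subset hx⟩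
    have huniv : F r s = univ := eq_univ_of_forall fun z => Subsingleton.elim y z ▸ hy
    have := hInt r s hr hs
    rw [huniv, interior_univ] at this
    exact univ_nonempty.ne_empty this
  | succ k ih =>
    refine ih.prod.of_reidx (f := fun p => Fin.snoc (α := fun _ => R) p.1 p.2)
      (g := fun z => (z ∘ Fin.castSucc, z (Fin.last k))) ?_
      ((Reidx.restrict _).prodMk (Reidx.eval _)) ?_ ?_
    · refine ⟨Fin.snoc (α := fun _ => Coord.ι R ((Fin k → R) × R)) Sum.inl (Sum.inr ()),
        fun p (i : Fin (k + 1)) => ?_⟩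
      refine Fin.lastCases ?_ (fun i => ?_) i
      · rw [co_pi, Fin.snoc_last]
        beta_reduce
        rw [Fin.snoc_last]
        rfl
      · rw [co_pi, Fin.snoc_castSucc]
        beta_reduce
        rw [Fin.snoc_castSucc]
        rfl
    · exact fun z => Fin.snoc_init_self z
    · rintro ⟨x, y⟩
      simp [Function.comp_def]

/-- Induction on the bound. Either two points of the fiber of `Z` stay a fixed distance apart over
an open set, and concentrating `V` in a short interval discards one of them, or the fibers have at
most one point off a nowhere dense set. -/
theorem IsBaire.exists_subsingleton_of_encard_le (hT : IsBaire L R T) {Z V : Set (T × R)}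
    (hZ : DSig L R Z) (hV : DSig L R V) (N : ℕ) : ∀ (W : Set T) (p q : R), IsOpen W → W.Nonempty →
    (∀ w ∈ W, ∃ y ∈ Ioo p q, (w, y) ∈ V) → (∀ w ∈ W, ({y | (w, y) ∈ Z} ∩ Ioo p q).encard ≤ N) →
    ∃ (W' : Set T) (p' q' : R), IsOpen W' ∧ W'.Nonempty ∧ W' ⊆ W ∧
      (∀ w ∈ W', ∃ y ∈ Ioo p' q', (w, y) ∈ V) ∧
      ∀ w ∈ W', ({y | (w, y) ∈ Z} ∩ Ioo p' q').Subsingleton := by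
  obtain ⟨F, hF, rfl⟩ := hZ
  induction N with
  | zero =>
    intro W p q hW hne hWV hN
    refine ⟨W, p, q, hW, hne, Subset.rfl, hWV, fun w hw => ?_⟩
    have : {y | (w, y) ∈ uni F} ∩ Ioo p q = ∅ := by simpa using hN w hw
    rw [this]
    exact subsingleton_empty
  | succ N ih =>
    intro W p q hW hne hWV hN
    -- Pairs of points of `Z` in one fiber, at distance at least `s` from each other and from the
    -- ends of the interval. The margins keep the members closed although the interval is open.
    set H : R → R → Set (T × (R × R)) := fun r s => {z | (z.1, z.2.1) ∈ F r s ∧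
      (z.1, z.2.2) ∈ F r s ∧ p + s ≤ z.2.1 ∧ z.2.1 + s ≤ z.2.2 ∧ z.2.2 + s ≤ q} with hHdef
    have hH : DFam L H := by
      refine ⟨?_, ?_, ?_, ?_, ?_⟩
      · have h1 := @hF.defn.mem₂
        simp only [DefFam, hHdef, mem_ofPred_eq]
        fun_prop
      · intro r s hr hs
        refine ((hF.isClosed r s hr hs).preimage (by fun_prop)).inter
          (((hF.isClosed r s hr hs).preimage (by fun_prop)).inter
          ((isClosed_le ?_ ?_).inter ((isClosed_le ?_ ?_).inter (isClosed_le ?_ ?_)))) <;> fun_prop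
      · intro r s hr hs
        obtain ⟨M, hM⟩ := hF.bdd r s hr hs
        refine ⟨M, fun z hz => ?_⟩
        rw [forall_index_prod]
        refine ⟨fun i => hM _ hz.1 (Sum.inl i), ?_⟩
        rw [forall_index_prod]
        exact ⟨fun i => hM _ hz.1 (Sum.inr i), fun i => hM _ hz.2.1 (Sum.inr i)⟩
      · exact fun r r' s hr hs h z hz =>
          ⟨hF.mono r r' s hr hs h hz.1, hF.mono r r' s hr hs h hz.2.1, hz.2.2⟩
      · rintro r s s' hr hs h z ⟨h1, h2, h3, h4, h5⟩
        exact ⟨hF.anti r s s' hr hs h h1, hF.anti r s s' hr hs h h2, le_trans (by gcongr) h3,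
          le_trans (by gcongr) h4, le_trans (by gcongr) h5⟩
    have hE := hH.image (Reidx.fst (R := R))
    by_cases hcl : W ⊆ closure (uni fun r s => Prod.fst '' H r s)
    · obtain ⟨r, s, hr, hs, hne'⟩ := hT.exists_inter_interior hE hW hne hcl
      have hV' : DSig L R (V ∩ {z : T × R | z.2 ∈ Ioo p q}) := by
        refine hV.inter (DSig.of_isOpen (isOpen_Ioo.preimage continuous_snd) ?_)
        simp only [mem_ofPred_eq, mem_Ioo]
        fun_prop
      obtain ⟨b, -, c, hbc⟩ := hT.exists_concentrated hV' (hW.inter isOpen_interior) hne' (by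
        intro w hw
        obtain ⟨y, hy, hyV⟩ := hWV w hw.1
        exact ⟨(w, y), ⟨hyV, hy⟩, rfl⟩)
      -- The interval about `c` of radius `h` has length at most `s`, so it cannot contain both
      -- points of a pair.
      obtain ⟨h, hh, hhs⟩ := exists_add_self_le hs
      obtain ⟨W', hW', hneW', hsub, -, hW'V⟩ := hbc h h hh hh
      obtain ⟨W'', p', q', h1, h2, h3, h4⟩ := ih W' (max p (c - h)) (min q (c + h)) hW' hneW' (by
        intro w hw
        obtain ⟨y, ⟨hyV, hypq⟩, hyc⟩ := hW'V w hw
        rw [abs_sub_lt_iff] at hyc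
        exact ⟨y, ⟨max_lt hypq.1 (sub_lt_comm.1 hyc.2),
          lt_min hypq.2 (sub_lt_iff_lt_add'.1 hyc.1)⟩, hyV⟩) (by
        intro w hw
        obtain ⟨⟨w, y₁, y₂⟩, ⟨h1, h2, h3, h4, h5⟩, rfl⟩ := interior_subset (hsub hw).2
        simp only at h1 h2 h3 h4 h5
        have hy₁p : p < y₁ := (lt_add_of_pos_right p hs).trans_le h3
        have hy₁₂ : y₁ < y₂ := (lt_add_of_pos_right y₁ hs).trans_le h4
        have hy₂q : y₂ < q := (lt_add_of_pos_right y₂ hs).trans_le h5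
        obtain ⟨y, hyZ, hypq, hyn⟩ : ∃ y, (w, y) ∈ uni F ∧ y ∈ Ioo p q ∧
            y ∉ Ioo (c - h) (c + h) := by
          by_cases hy₁ : y₁ ∈ Ioo (c - h) (c + h)
          · refine ⟨y₂, subset_uni F hr hs h2, ⟨hy₁p.trans hy₁₂, hy₂q⟩, fun hy₂ => ?_⟩
            have h6 : y₁ + s < c + h := h4.trans_lt hy₂.2
            have h7 : c + h ≤ y₁ + s := by
              calc c + h = (c - h) + (h + h) := by abel
                _ ≤ y₁ + s := add_le_add hy₁.1.le hhs
            exact h6.not_ge h7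
          · exact ⟨y₁, subset_uni F hr hs h1, ⟨hy₁p, hy₁₂.trans hy₂q⟩, hy₁⟩
        have hins : insert y ({y | (w, y) ∈ uni F} ∩ Ioo (max p (c - h)) (min q (c + h))) ⊆
            {y | (w, y) ∈ uni F} ∩ Ioo p q := by
          rintro z (rfl | ⟨hz, hz'⟩)
          · exact ⟨hyZ, hypq⟩
          · exact ⟨hz, (le_max_left _ _).trans_lt hz'.1, hz'.2.trans_le (min_le_left _ _)⟩
        have hcard := (encard_le_encard hins).trans (hN w (hsub hw).1)
        rw [encard_insert_of_notMem fun hmem => hyn ⟨(le_max_right _ _).trans_lt hmem.2.1,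
          hmem.2.2.trans_le (min_le_right _ _)⟩] at hcard
        push_cast at hcard
        exact (ENat.add_le_add_iff_right ENat.one_ne_top).1 hcard)
      exact ⟨W'', p', q', h1, h2, h3.trans fun w hw => (hsub hw).1, h4⟩
    · refine ⟨W \ closure (uni fun r s => Prod.fst '' H r s), p, q, hW.sdiff isClosed_closure,
        sdiff_nonempty.2 hcl, sdiff_subset, fun w hw => hWV w hw.1, fun w hw => ?_⟩
      have main : ∀ y₁ ∈ {y | (w, y) ∈ uni F} ∩ Ioo p q, ∀ y₂ ∈ {y | (w, y) ∈ uni F} ∩ Ioo p q,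
          ¬ y₁ < y₂ := by
        rintro y₁ ⟨⟨r₁, s₁, hr₁, hs₁, h₁⟩, hy₁⟩ y₂ ⟨⟨r₂, s₂, hr₂, hs₂, h₂⟩, hy₂⟩ hlt
        have hev : ∀ᶠ s in 𝓝[>] (0 : R), 0 < s ∧ s < s₁ ∧ s < s₂ ∧ s < y₁ - p ∧ s < y₂ - y₁ ∧
            s < q - y₂ := by
          have hlt' : ∀ t : R, 0 < t → ∀ᶠ s in 𝓝[>] (0 : R), s < t := fun t ht =>
            nhdsWithin_le_nhds (Iio_mem_nhds ht)
          filter_upwards [self_mem_nhdsWithin, hlt' s₁ hs₁, hlt' s₂ hs₂, hlt' _ (sub_pos.2 hy₁.1),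
            hlt' _ (sub_pos.2 hlt), hlt' _ (sub_pos.2 hy₂.2)] with s a1 a2 a3 a4 a5 a6
          exact ⟨a1, a2, a3, a4, a5, a6⟩
        obtain ⟨s, hs, a2, a3, a4, a5, a6⟩ := hev.exists
        refine hw.2 (subset_closure ⟨max r₁ r₂, s, lt_max_of_lt_left hr₁, hs, (w, y₁, y₂),
          ⟨?_, ?_, ?_, ?_, ?_⟩, rfl⟩)
        · exact hF.subset hr₁ (le_max_left _ _) hs a2.le h₁
        · exact hF.subset hr₂ (le_max_right _ _) hs a3.le h₂
        · exact (lt_sub_iff_add_lt'.1 a4).le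
        · exact (lt_sub_iff_add_lt'.1 a5).le
        · exact (lt_sub_iff_add_lt'.1 a6).le
      intro y₁ h₁ y₂ h₂
      exact le_antisymm (not_lt.1 (main y₂ h₂ y₁ h₁)) (not_lt.1 (main y₁ h₁ y₂ h₂))

/-- Without interior, `Z` has closed discrete fibers generically. The uniform bound on them is taken
at a point where `V` concentrates, so that `V` survives the restriction to the place where the bound
holds. -/
theorem IsBaire.exists_subsingleton (hT : IsBaire L R T) {Z V : Set (T × R)}
    (hZ : DSig L R Z) (hV : DSig L R V) (hInt : interior Z = ∅) {W : Set T} (hW : IsOpen W)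
    (hne : W.Nonempty) (hWV : W ⊆ Prod.fst '' V) :
    ∃ (W' : Set T) (p q : R), IsOpen W' ∧ W'.Nonempty ∧ W' ⊆ W ∧
      (∀ w ∈ W', ∃ y ∈ Ioo p q, (w, y) ∈ V) ∧
      ∀ w ∈ W', ({y | (w, y) ∈ Z} ∩ Ioo p q).Subsingleton := by
  obtain ⟨F, hF, rfl⟩ := id hZ
  obtain ⟨W₁, hW₁, hne₁, hsub₁, hloc⟩ := hT.exists_forall_loc hF
    (fun r s hr hs => subset_empty_iff.1 (hInt ▸ interior_mono (subset_uni F hr hs))) hW hne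
  obtain ⟨b, hb, c, hbc⟩ := hT.exists_concentrated hV hW₁ hne₁ (hsub₁.trans hWV)
  obtain ⟨N, ε, hε, hN⟩ := exists_encard_le (L := L) (X := fun w : T => {y | (w, y) ∈ uni F})
    hF.defP_uni b c
  obtain ⟨W₂, hW₂, hne₂, hsub₂, hnear, hWV₂⟩ := hbc ε ε hε hε
  obtain ⟨W', p, q, h1, h2, h3, h4⟩ := hT.exists_subsingleton_of_encard_le hZ hV N W₂ (c - ε)
    (c + ε) hW₂ hne₂ (by
      intro w hw
      obtain ⟨y, hyV, hyc⟩ := hWV₂ w hw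
      rw [abs_sub_lt_iff] at hyc
      exact ⟨y, ⟨sub_lt_comm.1 hyc.2, sub_lt_iff_lt_add'.1 hyc.1⟩, hyV⟩) (by
      intro w hw
      exact (encard_le_encard (inter_subset_inter_right _ Ioo_subset_Icc_self)).trans
        (hN w (hnear w hw) (hloc w (hsub₂ hw))))
  exact ⟨W', p, q, h1, h2, h3.trans (hsub₂.trans hsub₁), h4⟩

/-! ### Dimension and the locus where a set is not locally closed -/

section Dimension

variable {ι : Type} [Finite ι]

theorem isOpen_box (J : Set ι) (p q : ι → R) :
    IsOpen {x : ι → R | ∀ j : J, x j ∈ Ioo (p j) (q j)} := by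
  simp only [ofPred_forall]
  exact isOpen_iInter_of_finite fun j => isOpen_Ioo.preimage (continuous_apply _)

theorem dSig_box (J : Set ι) (p q : ι → R) :
    DSig L R {x : ι → R | ∀ j : J, x j ∈ Ioo (p j) (q j)} := by
  refine DSig.of_isOpen (isOpen_box J p q) ?_
  have h : ∀ j : ι, DefF L R fun x : ι → R => x j := fun j => DefF.of_reidx (Reidx.eval j)
  simp only [mem_ofPred_eq, mem_Ioo]
  exact DefP.forall_index fun j => (DefP.lt (DefF.const _) (h j)).and (DefP.lt (h j) (DefF.const _))

/-- If the part of `X` where `X` is not locally closed has a full-dimensional projection, then a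
projection of `X` to one more coordinate is full-dimensional. -/
theorem DSig.exists_interior_nonempty {X : Set (ι → R)} (hX : DSig L R X) {k : ℕ}
    (σ : Fin k → ι)
    (hY : (interior ((fun x : ι → R => x ∘ σ) '' (X ∩ closure (closure X \ X)))).Nonempty) :
    ∃ j, (interior ((fun x : ι → R => (x ∘ σ, x j)) '' X)).Nonempty := by
  by_contra! hInt
  have hT : IsBaire L R (Fin k → R) := isBaire_pi k
  have hπ : Reidx R fun x : ι → R => x ∘ σ := Reidx.restrict σ
  have hC : DSig L R (closure (closure X \ X)) := by
    refine DSig.of_isClosed isClosed_closure (DefP.closure ?_)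
    have h1 := @hX.defP.mem
    have h2 := @hX.defP.closure.mem
    simp only [mem_sdiff]
    fun_prop
  set C := closure (closure X \ X) with hCdef
  -- Coordinates are treated one by one: over `W` each coordinate in `J` of a point of `X` has at
  -- most one value in its interval, and some point of `X ∩ C` keeps all these coordinates in their
  -- intervals.
  have key : ∀ J : Set ι, J.Finite → ∃ (W : Set (Fin k → R)) (p q : ι → R), IsOpen W ∧ W.Nonempty ∧
      (∀ w ∈ W, ∃ x ∈ X ∩ C, x ∘ σ = w ∧ ∀ j ∈ J, x j ∈ Ioo (p j) (q j)) ∧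
      ∀ w ∈ W, ∀ j ∈ J, ({y | (w, y) ∈ (fun x : ι → R => (x ∘ σ, x j)) '' X} ∩
        Ioo (p j) (q j)).Subsingleton := by
    intro J hJ
    induction J, hJ using Set.Finite.induction_on with
    | empty =>
      refine ⟨_, 0, 0, isOpen_interior, hY, fun w hw => ?_, by simp⟩
      obtain ⟨x, hx, rfl⟩ := interior_subset hw
      exact ⟨x, hx, rfl, by simp⟩
    | @insert j J hj _ ih =>
      classical
      obtain ⟨W, p, q, hW, hne, hWX, hWs⟩ := ih
      have hf : Reidx R fun x : ι → R => (x ∘ σ, x j) := hπ.prodMk (Reidx.eval j)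
      obtain ⟨W', p', q', hW', hne', hsub, hWV, hsing⟩ := hT.exists_subsingleton (hX.image hf)
        (((hX.inter hC).inter (dSig_box J p q)).image hf) (hInt j) hW hne (by
          intro w hw
          obtain ⟨x, hx, rfl, hxJ⟩ := hWX w hw
          exact ⟨(x ∘ σ, x j), ⟨x, ⟨hx, fun i => hxJ i i.2⟩, rfl⟩, rfl⟩)
      refine ⟨W', Function.update p j p', Function.update q j q', hW', hne', ?_, ?_⟩
      · intro w hw
        obtain ⟨y, hy, x, ⟨hx, hxJ⟩, hxw⟩ := hWV w hw
        rw [Prod.mk.injEq] at hxw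
        refine ⟨x, hx, hxw.1, fun i hi => ?_⟩
        by_cases hij : i = j
        · subst hij
          simpa [hxw.2] using hy
        · simpa [hij] using hxJ ⟨i, hi.resolve_left hij⟩
      · intro w hw i hi
        by_cases hij : i = j
        · subst hij
          simpa using hsing w hw
        · simpa [hij] using hWs w (hsub hw) i (hi.resolve_left hij)
  obtain ⟨W, p, q, hW, hne, hWX, hWs⟩ := key univ finite_univ
  obtain ⟨F, hF, hFX⟩ := hX
  obtain ⟨G, hG, hGC⟩ := hC.inter (dSig_box univ p q)
  -- A single pair `r`, `s` serves over an open part of the base: there some point of the closed set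
  -- `F r s` lies in the box, and it is the only point of `X` in the box above its base point.
  obtain ⟨r, s, hr, hs, w, hwW, hw⟩ := hT.exists_inter_interior ((hF.inter hG).image hπ) hW hne (by
    rw [DFam.uni_image, hF.uni_inter hG, ← hFX, ← hGC]
    refine Subset.trans (fun w hw => ?_) subset_closure
    obtain ⟨x, hx, rfl, hxJ⟩ := hWX w hw
    exact ⟨x, ⟨hx.1, hx.2, fun j => hxJ j trivial⟩, rfl⟩)
  obtain ⟨y, ⟨-, hyC⟩, rfl, hyJ⟩ := hWX w hwW
  set O : Set (ι → R) := {x | ∀ j : (univ : Set ι), x j ∈ Ioo (p j) (q j)} ∩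
    (fun x : ι → R => x ∘ σ) ⁻¹' (W ∩ interior ((fun x : ι → R => x ∘ σ) '' (F r s ∩ G r s)))
  have hO : IsOpen O :=
    (isOpen_box univ p q).inter ((hW.inter isOpen_interior).preimage hπ.continuous)
  -- As `y` lies in `C`, the open set `O` contains a point `z` of the closure of `X` outside `X`.
  -- But inside `O` all of `X` lies in the closed set `F r s`, which forces `z` into `X`.
  obtain ⟨z, hzO, hzcl, hzX⟩ := mem_closure_iff.1 hyC O hO ⟨fun j => hyJ j trivial, hwW, hw⟩
  have hXO : X ∩ O ⊆ F r s := by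
    rintro x ⟨hxX, hxJ, hxW, hxi⟩
    obtain ⟨x', ⟨hx'F, hx'G⟩, hx'x⟩ := interior_subset hxi
    have hx'2 : x' ∈ C ∩ {x | ∀ j : (univ : Set ι), x j ∈ Ioo (p j) (q j)} := by
      rw [hGC]
      exact subset_uni G hr hs hx'G
    have hx'X : x' ∈ X := hFX ▸ subset_uni F hr hs hx'F
    have : x = x' := by
      funext j
      exact hWs (x ∘ σ) hxW j trivial ⟨⟨x, hxX, rfl⟩, hxJ ⟨j, trivial⟩⟩
        ⟨⟨x', hx'X, Prod.ext hx'x rfl⟩, hx'2.2 ⟨j, trivial⟩⟩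
    exact this ▸ hx'F
  refine hzX (hFX ▸ subset_uni F hr hs ?_)
  rw [← (hF.isClosed r s hr hs).closure_eq, mem_closure_iff]
  intro U hU hzU
  obtain ⟨x, ⟨hxU, hxO⟩, hxX⟩ := mem_closure_iff.1 hzcl (U ∩ O) (hU.inter hO) ⟨hzU, hzO⟩
  exact ⟨x, hxU, hXO ⟨hxX, hxO⟩⟩

theorem interior_snoc_nonempty {X : Set (ι → R)} {k : ℕ} {σ : Fin k → ι} {j : ι}
    (h : (interior ((fun x : ι → R => (x ∘ σ, x j)) '' X)).Nonempty) :
    (interior ((fun x : ι → R => x ∘ (Fin.snoc σ j : Fin (k + 1) → ι)) '' X)).Nonempty := by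
  obtain ⟨⟨w, y⟩, hwy⟩ := h
  have hg : Continuous fun z : Fin (k + 1) → R => (z ∘ Fin.castSucc, z (Fin.last k)) := by
    fun_prop
  refine ⟨Fin.snoc w y, mem_interior.2 ⟨_, ?_,
    (isOpen_interior (s := (fun x : ι → R => (x ∘ σ, x j)) '' X)).preimage hg, ?_⟩⟩
  · intro z hz
    obtain ⟨x, hx, hxz⟩ := interior_subset hz
    rw [Prod.mk.injEq] at hxz
    refine ⟨x, hx, funext fun i => ?_⟩
    refine Fin.lastCases ?_ (fun i => ?_) i
    · simpa using hxz.2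
    · simpa using congrFun hxz.1 i
  · simpa [Function.comp_def] using hwy

/-- A repeated coordinate would confine the projection to a diagonal, and moving one of the two
equal coordinates leaves it. -/
theorem injective_of_interior_nonempty {X : Set (ι → R)} {k : ℕ} {σ : Fin k → ι}
    (h : (interior ((fun x : ι → R => x ∘ σ) '' X)).Nonempty) : Function.Injective σ := by
  intro a b hab
  by_contra hne
  obtain ⟨z, hz⟩ := h
  obtain ⟨ε, hε, hz'⟩ := (mem_interior_iff_near (R := R)).1 hz
  obtain ⟨δ, hδ, hδε⟩ := exists_between hε
  obtain ⟨x, -, hx⟩ := interior_subset hz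
  obtain ⟨x', -, hx'⟩ := hz' (Function.update z a (z a + δ)) (fun (i : Fin k) => by
    simp only [co_pi]
    by_cases hi : i = a
    · subst hi
      simpa [abs_of_pos hδ] using hδε
    · simpa [hi] using hε)
  have h1 : z a = z b := by rw [← hx]; simp [hab]
  have h2 := congrFun hx' a
  have h3 := congrFun hx' b
  simp only [Function.comp_apply, Function.update_self] at h2
  simp only [Function.comp_apply, Function.update_of_ne (Ne.symm hne)] at h3
  rw [hab, h3, h1] at h2
  exact hδ.ne' (by simpa using h2)

/-- Induction on a strict bound `d` for the dimension. Bound `0` means empty, since a nonempty set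
projects onto the one-point space $R^0$. Otherwise, with $C=\overline{\overline X\setminus X}$, both
claims pass from $X\cap C$ to $X=(\overline X\setminus C)\cup(X\cap C)$. The complement is
$((\overline X)^c\cup C)\cap(X\cap C)^c$, built from $D_\Sigma$-sets. -/
theorem DSig.isBoolCombOfOpen_and_compl_of_dim (d : ℕ) : ∀ X : Set (ι → R), DSig L R X →
    (∀ k, d ≤ k → ∀ σ : Fin k → ι, ¬ (interior ((fun x : ι → R => x ∘ σ) '' X)).Nonempty) →
    IsBoolCombOfOpen X ∧ DSig L R Xᶜ := by
  induction d with
  | zero =>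
    intro X hX hdim
    have hemp : X = ∅ := by
      by_contra hne
      obtain ⟨x, hx⟩ := nonempty_iff_ne_empty.2 hne
      refine hdim 0 le_rfl Fin.elim0 ?_
      have : (fun x : ι → R => x ∘ (Fin.elim0 : Fin 0 → ι)) '' X = univ :=
        eq_univ_of_forall fun z => ⟨x, hx, Subsingleton.elim _ _⟩
      rw [this, interior_univ]
      exact univ_nonempty
    subst hemp
    refine ⟨BooleanSubalgebra.bot_mem, ?_⟩
    rw [compl_empty]
    exact DSig.of_isClosed isClosed_univ (DefP.const True)
  | succ d ih =>
    intro X hX hdim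
    have hXcl := hX.defP.closure
    have hCdef : DefP L R fun x => x ∈ closure (closure X \ X) := by
      refine DefP.closure ?_
      have h1 := @hX.defP.mem
      have h2 := @hXcl.mem
      simp only [mem_sdiff]
      fun_prop
    have hC : DSig L R (closure (closure X \ X)) := DSig.of_isClosed isClosed_closure hCdef
    obtain ⟨hYb, hYc⟩ := ih _ (hX.inter hC) (by
      intro k hk σ hσ
      obtain ⟨j, hj⟩ := hX.exists_interior_nonempty σ hσ
      exact hdim (k + 1) (by lia) _ (interior_snoc_nonempty hj))
    have hdecomp : X = (closure X \ closure (closure X \ X)) ∪ (X ∩ closure (closure X \ X)) := by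
      ext x
      constructor
      · intro hx
        by_cases hxC : x ∈ closure (closure X \ X)
        · exact Or.inr ⟨hx, hxC⟩
        · exact Or.inl ⟨subset_closure hx, hxC⟩
      · rintro (⟨hx, hxC⟩ | ⟨hx, -⟩)
        · by_contra hxX
          exact hxC (subset_closure ⟨hx, hxX⟩)
        · exact hx
    have hclosed : ∀ A : Set (ι → R), IsClosed A → IsBoolCombOfOpen A := by
      intro A hA
      have : Aᶜ ∈ BooleanSubalgebra.closure {U : Set (ι → R) | IsOpen U} :=
        BooleanSubalgebra.subset_closure hA.isOpen_compl
      exact BooleanSubalgebra.compl_mem_iff.1 this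
    constructor
    · rw [hdecomp]
      exact BooleanSubalgebra.sup_mem
        (BooleanSubalgebra.sdiff_mem (hclosed _ isClosed_closure) (hclosed _ isClosed_closure)) hYb
    · rw [hdecomp, compl_union, Set.sdiff_eq, compl_inter, compl_compl]
      refine DSig.inter (DSig.union (DSig.of_isOpen isClosed_closure.isOpen_compl ?_) hC) hYc
      exact hXcl.not

theorem DSig.isBoolCombOfOpen_and_compl {X : Set (ι → R)} (hX : DSig L R X) :
    IsBoolCombOfOpen X ∧ DSig L R Xᶜ := by
  -- A selection of more coordinates than there are must repeat one, so its image has no interior.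
  refine DSig.isBoolCombOfOpen_and_compl_of_dim (Nat.card ι + 1) X hX fun k hk σ hσ => ?_
  have := Nat.card_le_card_of_injective σ (injective_of_interior_nonempty hσ)
  rw [Nat.card_fin] at this
  lia

end Dimension

/-! ### Sets definable in the open core -/

theorem DefF.pi {κ : Type} [Finite κ] {f : S → κ → R} (h : ∀ i, DefF L R fun x => f x i) :
    DefF L R f := by
  have h1 : ∀ i, DefP L R fun p : S × (κ → R) => f p.1 i = p.2 i := fun i =>
    DefP.eq ((h i).comp (DefF.of_reidx Reidx.fst))
      (DefF.of_reidx ((Reidx.eval i).comp Reidx.snd))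
  exact (DefP.forall_index h1).congr fun p => funext_iff

open FirstOrder FirstOrder.Language

/-- The only function symbols are the constants for parameters, so a term is a variable or a
constant. -/
theorem openCore_term_realize {β : Type} [Finite β]
    (t : ((openCoreLanguage L R)[[(univ : Set R)]]).Term β) :
    (DefF L R fun z : β → R => t.realize z) ∧ Continuous fun z : β → R => t.realize z := by
  cases t with
  | var i => exact ⟨DefF.of_reidx (Reidx.eval i), continuous_apply i⟩
  | @func l f ts =>
    cases l with
    | zero =>
      have : (fun z : β → R => (Term.func f ts).realize z) =
          fun _ => Structure.funMap f (default : Fin 0 → R) := by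
        funext z
        rw [Term.realize_func]
        congr 1
        exact Subsingleton.elim _ _
      rw [this]
      exact ⟨DefF.const _, continuous_const⟩
    | succ l =>
      obtain f | f := f
      · exact f.elim
      · exact isEmptyElim f

/-- Induction on formulas. Atomic formulas define closed sets or continuous preimages of open sets,
implication uses stability under complement and union, and the universal quantifier is the
complement of a projection of a complement. -/
theorem dSig_realize {α : Type} [Finite α] {n : ℕ}
    (φ : ((openCoreLanguage L R)[[(univ : Set R)]]).BoundedFormula α n) :
    DSig L R {z : α ⊕ Fin n → R | φ.Realize (z ∘ Sum.inl) (z ∘ Sum.inr)} := by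
  induction φ with
  | falsum =>
    exact DSig.of_isClosed (X := ∅) isClosed_empty (DefP.const False)
  | equal t₁ t₂ =>
    obtain ⟨h1, h1'⟩ := openCore_term_realize t₁
    obtain ⟨h2, h2'⟩ := openCore_term_realize t₂
    simp only [BoundedFormula.Realize, Sum.elim_comp_inl_inr]
    exact DSig.of_isClosed (isClosed_eq h1' h2') (DefP.eq h1 h2)
  | rel U ts =>
    obtain U | U := U
    · simp only [BoundedFormula.Realize, Sum.elim_comp_inl_inr]
      have hdef : DefP L R fun x => x ∈ U.1 := U.2.2
      have hset : {z | Structure.RelMap (L := (openCoreLanguage L R)[[(univ : Set R)]])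
          (Sum.inl U) fun i => (ts i).realize z} = (fun z i => (ts i).realize z) ⁻¹' U.1 := by
        ext z
        rw [mem_ofPred_eq, withConstants_relMap_sumInl]
        rfl
      rw [hset]
      exact DSig.of_isOpen
        (U.2.1.preimage (continuous_pi fun i => (openCore_term_realize (ts i)).2))
        (hdef.comp (DefF.pi fun i => (openCore_term_realize (ts i)).1))
    · exact U.elim
  | imp φ ψ hφ hψ =>
    have := hφ.isBoolCombOfOpen_and_compl.2.union hψ
    convert this using 1
    ext z
    simp only [BoundedFormula.Realize, mem_ofPred_eq, mem_union, mem_compl_iff]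
    exact imp_iff_not_or
  | @all n φ hφ =>
    have := (hφ.isBoolCombOfOpen_and_compl.2.image
      (Reidx.restrict (Sum.map id Fin.castSucc : α ⊕ Fin n → _))).isBoolCombOfOpen_and_compl.2
    convert this using 1
    ext z
    simp only [BoundedFormula.Realize, mem_ofPred_eq, mem_image, mem_compl_iff, not_exists, not_and]
    constructor
    · rintro h x hx rfl
      refine hx ?_
      have hx' : x ∘ Sum.inr = Fin.snoc (α := fun _ => R)
          ((x ∘ (Sum.map id Fin.castSucc : α ⊕ Fin n → _)) ∘ Sum.inr)
          (x (Sum.inr (Fin.last n))) := by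
        funext i
        refine Fin.lastCases ?_ (fun i => ?_) i <;> simp
      rw [hx']
      exact h (x (Sum.inr (Fin.last n)))
    · intro h y
      by_contra hcon
      refine h (Sum.elim (z ∘ Sum.inl) (Fin.snoc (z ∘ Sum.inr) y)) ?_ ?_
      · simpa using hcon
      · funext i
        rcases i with i | i <;> simp

theorem dSig_of_def_openCore {n : ℕ} {X : Set (Fin n → R)} (hX : Def (openCoreLanguage L R) X) :
    DSig L R X := by
  obtain ⟨φ, rfl⟩ := hX
  have := (dSig_realize φ).image (Reidx.restrict (R := R) (Sum.inl : Fin n → Fin n ⊕ Fin 0))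
  convert this using 1
  ext x
  simp only [mem_ofPred_eq, mem_image]
  constructor
  · intro h
    refine ⟨Sum.elim x default, ?_, by simp⟩
    rw [Sum.elim_comp_inl, Sum.elim_comp_inr]
    exact h
  · rintro ⟨z, hz, rfl⟩
    have : z ∘ Sum.inr = (default : Fin 0 → R) := Subsingleton.elim _ _
    rw [this] at hz
    exact hz

/-- For one parameter, the open interval provided around `0` has an endpoint below `0`. -/
theorem LUF₂.nontrivial {L : FirstOrder.Language.{u, v}} {R : Type w} [AddCommGroup R]
    [LinearOrder R] [TopologicalSpace R] [L.Structure R] (h : LUF₂ L R) : Nontrivial R := by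
  obtain ⟨_, _, _, _, _, u, v, hb, _⟩ := h 1 univ definable_univ 0 0
  exact ⟨⟨u 0, 0, (hb 0).1.ne⟩⟩

end OpenCore

theorem theorem5p7 (L : FirstOrder.Language.{u, v}) (R : Type w)
    [AddCommGroup R] [LinearOrder R] [IsOrderedAddMonoid R] [DenselyOrdered R]
    [TopologicalSpace R] [OrderTopology R] [L.Structure R]
    (hexp : OpenCore.ExpandsOrderedGroup L R)
    (hDC : OpenCore.DefinablyComplete L R)
    (hLUF : OpenCore.LUF₂ L R) :
    (∀ (n : ℕ) (X : Set (Fin n → R)),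
      OpenCore.IsDSigma L X → OpenCore.IsBoolCombOfOpen X) ∧
    (∀ (n : ℕ) (X : Set (Fin n → R)),
      OpenCore.Def (OpenCore.openCoreLanguage L R) X → OpenCore.IsBoolCombOfOpen X) := by
  have : OpenCore.Tame L R := ⟨hexp, hDC, hLUF⟩
  have : Nontrivial R := hLUF.nontrivial
  exact ⟨fun n X hX => hX.dSig.isBoolCombOfOpen_and_compl.1,
    fun n X hX => (OpenCore.dSig_of_def_openCore hX).isBoolCombOfOpen_and_compl.1⟩
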